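/- **Definitions.** Let $(X,d)$ be a non-empty compact metric space, $f:X\to X$ continuous and $x,y\in X$. For $\delta>0$ put $$\Phi_{(f,x,y)}(\delta)=\liminf_{n\to\infty}\tfrac1n\#\{0\le k\le n: d(f^k(x),f^k(y))<\delta\},\qquad \Phi^*_{(f,x,y)}(\delta)=\limsup_{n\to\infty}\tfrac1n\#\{0\le k\le n: d(f^k(x),f^k(y))<\delta\},$$ and $\Phi_{(f,x,y)}(0)=\lim_{\delta\to0^+}\Phi_{(f,x,y)}(\delta)$, $\Phi^*_{(f,x,y)}(0)=\lim_{\delta\to0^+}\Phi^*_{(f,x,y)}(\delta)$. The pair $(x,y)$ is * a DC2 pair if $\Phi^*_{(f,x,y)}(\delta)=1$ for all $0<\delta\le\operatorname{diam}X$ and $\Phi_{(f,x,y)}(\varepsilon)<1$ for some $0<\varepsilon\le\operatorname{diam}X$; * a DC2½ pair if $\Phi_{(f,x,y)}(0)<\Phi^*_{(f,x,y)}(0)$; * a DC3 pair if there are $0\le a<b\le\operatorname{diam}X$ with $\Phi_{(f,x,y)}(\delta)<\Phi^*_{(f,x,y)}(\delta)$ for all $\delta\in(a,b)$. A dendrite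 is a locally connected continuum (compact connected metric space) containing no subset homeomorphic to the circle. **Construction.** For $n\ge1$ let $h_n=3^{-n}$, $J_n=\{j\in\mathbb N:1\le j\le 3^n,\ 3\nmid j\}$, $z^{(n)}_j=j/3^n$, and let $$\mathcal D=\bigl([0,1]\times\{0\}\bigr)\cup\bigcup_{n\ge1}\bigcup_{j\in J_n}\{z^{(n)}_j\}\times[0,h_n]\subset\mathbb R^2$$ with the max metric. For $n\ge 1$ and $j\in J_n$ define $(w,h)=(w_{n,j},h_{n,j})$ by: * $n$ odd: $w=z^{(n)}_{j+1}$ if $j\equiv1\pmod 3$; $w=z^{(n)}_{j+2}$ if $j\equiv2\pmod 3$ and $j\ne3^n-1$; $w=z^{(n+1)}_{3^{n+1}-1}$ if $j=3^n-1$; * $n$ even: $w=z^{(n)}_{j-1}$ if $j\equiv2\pmod 3$; $w=z^{(n)}_{j-2}$ if $j\equiv1\pmod 3$ and $j\ne1$; $w=z^{(n+1)}_{1}$ if $j=1$; * $h=h_{n+1}$ if ($n$ is odd and $j=3^n-1$) or ($n$ is even and $j=1$), and $h=h_n$ otherwise. Let $\psi_{(n,j)}$ be the affine function on $[0,\frac23h_n]$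 with $\psi_{(n,j)}(0)=z^{(n)}_j$ and $\psi_{(n,j)}(\frac23h_n)=w$, and $\phi_{(n,j)}$ the increasing affine function mapping $[\frac23h_n,h_n]$ onto $[0,h]$. Define $f:\mathcal D\to\mathcal D$ by $f(x,0)=(x,0)$ for $x\in[0,1]$, and $$f(z^{(n)}_j,y)=\begin{cases}(\psi_{(n,j)}(y),0),&0<y\le\frac23h_n,\\ (w,\phi_{(n,j)}(y)),&\frac23h_n<y\le h_n.\end{cases}$$ **Theorem.** $\mathcal D$ is a dendrite and $f$ is continuous. The pair $\bigl((1,0),(\frac13,\frac13)\bigr)$ is a DC3 pair of $(\mathcal D,f)$, while $(\mathcal D,f)$ has no DC2 pair and no DC2½ pair. Consequently, for continuous self-maps of dendrites, the existence of a DC3 pair implies neither the existence of a DC2 pair nor the existence of a DC2½ pair. -/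

import Mathlib

open Set Filter Topology

namespace DistChaos

/-! ### Distributional chaos -/

section Pairs

variable {X : Type*} [MetricSpace X]

/-- The number of times `0 ≤ k ≤ n` at which the orbits of `x` and `y` under `f`
are closer than `δ`, divided by `n`. -/
noncomputable def closeFreq (f : X → X) (x y : X) (δ : ℝ) (n : ℕ) : ℝ :=
  (1 / (n : ℝ)) * ({k : ℕ | k ≤ n ∧ dist (f^[k] x) (f^[k] y) < δ}.ncard : ℝ)

/-- The lower distribution function `Φ_{(f,x,y)}` (for positive arguments). -/
noncomputable def lowerDist (f : X → X) (x y : X) (δ : ℝ) : ℝ :=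
  liminf (fun n : ℕ => closeFreq f x y δ n) atTop

/-- The upper distribution function `Φ*_{(f,x,y)}` (for positive arguments). -/
noncomputable def upperDist (f : X → X) (x y : X) (δ : ℝ) : ℝ :=
  limsup (fun n : ℕ => closeFreq f x y δ n) atTop

/-- The value at `0` of the lower distribution function, defined as its right limit there. -/
noncomputable def lowerDistZero (f : X → X) (x y : X) : ℝ :=
  limUnder (𝓝[>] (0 : ℝ)) (lowerDist f x y)

/-- The value at `0` of the upper distribution function, defined as its right limit there. -/
noncomputable def upperDistZero (f : X → X) (x y : X) : ℝ :=
  limUnder (𝓝[>] (0 : ℝ)) (upperDist f x y)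

/-- `(x, y)` is distributionally scrambled of type 2. -/
def IsDC2Pair (f : X → X) (x y : X) : Prop :=
  (∀ δ : ℝ, 0 < δ → δ ≤ Metric.diam (univ : Set X) → upperDist f x y δ = 1) ∧
    ∃ ε : ℝ, 0 < ε ∧ ε ≤ Metric.diam (univ : Set X) ∧ lowerDist f x y ε < 1

/-- `(x, y)` is distributionally scrambled of type 2½. -/
def IsDC2HalfPair (f : X → X) (x y : X) : Prop :=
  lowerDistZero f x y < upperDistZero f x y

/-- `(x, y)` is distributionally scrambled of type 3. -/
def IsDC3Pair (f : X → X) (x y : X) : Prop :=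
  ∃ a b : ℝ, 0 ≤ a ∧ a < b ∧ b ≤ Metric.diam (univ : Set X) ∧
    ∀ δ ∈ Ioo a b, lowerDist f x y δ < upperDist f x y δ

/-! The frequencies are bounded and monotone in `δ`, so that the lower and upper limits, and the
right limits at `0`, are genuine. -/

theorem finite_closeTimes (f : X → X) (x y : X) (δ : ℝ) (n : ℕ) :
    {k : ℕ | k ≤ n ∧ dist (f^[k] x) (f^[k] y) < δ}.Finite :=
  (Set.finite_Iic n).subset fun _ hk => hk.1

theorem closeFreq_nonneg (f : X → X) (x y : X) (δ : ℝ) (n : ℕ) : 0 ≤ closeFreq f x y δ n := by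
  unfold closeFreq; positivity

theorem closeFreq_le_two (f : X → X) (x y : X) (δ : ℝ) (n : ℕ) : closeFreq f x y δ n ≤ 2 := by
  unfold closeFreq
  rcases Nat.eq_zero_or_pos n with rfl | hn
  · simp
  · have h1 : {k : ℕ | k ≤ n ∧ dist (f^[k] x) (f^[k] y) < δ}.ncard ≤ n + 1 := by
      have := Set.ncard_le_ncard (s := {k : ℕ | k ≤ n ∧ dist (f^[k] x) (f^[k] y) < δ})
        (t := ((Finset.range (n + 1) : Finset ℕ) : Set ℕ))
        (fun k hk => by simpa using Nat.lt_succ_of_le hk.1) (Finset.finite_toSet _)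
      rwa [Set.ncard_coe_finset, Finset.card_range] at this
    have h2 : ({k : ℕ | k ≤ n ∧ dist (f^[k] x) (f^[k] y) < δ}.ncard : ℝ) ≤ n + 1 := by
      exact_mod_cast h1
    have hn' : (1 : ℝ) ≤ n := by exact_mod_cast hn
    rw [one_div, inv_mul_le_iff₀ (by linarith)]
    linarith

theorem closeFreq_mono (f : X → X) (x y : X) (n : ℕ) :
    Monotone fun δ => closeFreq f x y δ n := by
  intro δ δ' h
  unfold closeFreq
  refine mul_le_mul_of_nonneg_left ?_ (by positivity)
  have hsub : {k : ℕ | k ≤ n ∧ dist (f^[k] x) (f^[k] y) < δ} ⊆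
      {k : ℕ | k ≤ n ∧ dist (f^[k] x) (f^[k] y) < δ'} := fun k hk => ⟨hk.1, hk.2.trans_le h⟩
  exact_mod_cast Set.ncard_le_ncard hsub (finite_closeTimes f x y δ' n)

theorem isBoundedUnder_le_closeFreq (f : X → X) (x y : X) (δ : ℝ) :
    IsBoundedUnder (· ≤ ·) atTop fun n : ℕ => closeFreq f x y δ n :=
  isBoundedUnder_of ⟨2, closeFreq_le_two f x y δ⟩

theorem isBoundedUnder_ge_closeFreq (f : X → X) (x y : X) (δ : ℝ) :
    IsBoundedUnder (· ≥ ·) atTop fun n : ℕ => closeFreq f x y δ n :=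
  isBoundedUnder_of ⟨0, closeFreq_nonneg f x y δ⟩

theorem lowerDist_mono (f : X → X) (x y : X) : Monotone (lowerDist f x y) := fun _ _ h =>
  liminf_le_liminf (Eventually.of_forall fun n => closeFreq_mono f x y n h)
    (isBoundedUnder_ge_closeFreq f x y _) (isBoundedUnder_le_closeFreq f x y _).isCoboundedUnder_ge

theorem upperDist_mono (f : X → X) (x y : X) : Monotone (upperDist f x y) := fun _ _ h =>
  limsup_le_limsup (Eventually.of_forall fun n => closeFreq_mono f x y n h)
    (isBoundedUnder_ge_closeFreq f x y _).isCoboundedUnder_le (isBoundedUnder_le_closeFreq f x y _)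

theorem tendsto_lowerDistZero (f : X → X) (x y : X) :
    Tendsto (lowerDist f x y) (𝓝[>] 0) (𝓝 (lowerDistZero f x y)) :=
  tendsto_nhds_limUnder ⟨_, (lowerDist_mono f x y).tendsto_nhdsGT 0⟩

theorem tendsto_upperDistZero (f : X → X) (x y : X) :
    Tendsto (upperDist f x y) (𝓝[>] 0) (𝓝 (upperDistZero f x y)) :=
  tendsto_nhds_limUnder ⟨_, (upperDist_mono f x y).tendsto_nhdsGT 0⟩

end Pairs

/-- A dendrite: a locally connected continuum that contains no simple closed curve. -/
def IsDendrite (X : Type*) [MetricSpace X] : Prop :=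
  CompactSpace X ∧ ConnectedSpace X ∧ LocallyConnectedSpace X ∧
    ∀ S : Set X, ¬ Nonempty (S ≃ₜ Circle)

/-! ### The comb dendrite -/

/-- The indices `J n = {j : 1 ≤ j ≤ 3 ^ n, 3 ∤ j}` of the spikes of level `n`. -/
def spikeIndices (n : ℕ) : Set ℕ := {j | 1 ≤ j ∧ j ≤ 3 ^ n ∧ ¬ 3 ∣ j}

/-- The base abscissa `j / 3 ^ n`. -/
noncomputable def spikeBase (n j : ℕ) : ℝ := (j : ℝ) / 3 ^ n

/-- The height `1 / 3 ^ n` of the spikes of level `n`. -/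
noncomputable def spikeHeight (n : ℕ) : ℝ := 1 / 3 ^ n

/-- The comb: the unit interval, and at each `j / 3 ^ n` (`1 ≤ n`, `j ∈ J n`) a spike of height
`1 / 3 ^ n`. The metric of `ℝ × ℝ` is the max metric. -/
def comb : Set (ℝ × ℝ) :=
  (Icc (0 : ℝ) 1 ×ˢ {(0 : ℝ)}) ∪
    ⋃ n ∈ {n : ℕ | 1 ≤ n}, (spikeBase n '' spikeIndices n) ×ˢ Icc (0 : ℝ) (spikeHeight n)

/-! ### The map -/

/-- The spikes that are mapped to a spike of the next level: the rightmost spike of an odd level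
and the leftmost spike of an even level. -/
def IsLastSpike (n j : ℕ) : Prop := (Odd n ∧ j = 3 ^ n - 1) ∨ (Even n ∧ j = 1)

open Classical in
/-- The base of the spike onto which the `j`-th spike of level `n` is stretched: on odd levels the
next spike of the same level to the right, on even levels the next one to the left, and, from the
last spike of a level, the first spike to be visited on the next level. -/
noncomputable def nextBase (n j : ℕ) : ℝ :=
  if Odd n then
    if j = 3 ^ n - 1 then spikeBase (n + 1) (3 ^ (n + 1) - 1)
    else if j % 3 = 1 then spikeBase n (j + 1)
    else spikeBase n (j + 2)
  else
    if j = 1 then spikeBase (n + 1) 1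
    else if j % 3 = 2 then spikeBase n (j - 1)
    else spikeBase n (j - 2)

open Classical in
/-- The height of that spike. -/
noncomputable def nextHeight (n j : ℕ) : ℝ :=
  if IsLastSpike n j then spikeHeight (n + 1) else spikeHeight n

/-- `ψ_{(n,j)}`: the affine function on `[0, (2/3) h_n]` with `ψ(0)` the base of the spike and
`ψ((2/3) h_n)` the base of the next spike. -/
noncomputable def lowerPart (n j : ℕ) (t : ℝ) : ℝ :=
  spikeBase n j + t / (2 / 3 * spikeHeight n) * (nextBase n j - spikeBase n j)

/-- `φ_{(n,j)}`: the increasing affine function from `[(2/3) h_n, h_n]` onto `[0, h]`, where `h`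
is the height of the next spike. -/
noncomputable def upperPart (n j : ℕ) (t : ℝ) : ℝ :=
  (t - 2 / 3 * spikeHeight n) / (spikeHeight n - 2 / 3 * spikeHeight n) * nextHeight n j

/-- The level of the spike at the abscissa `s`: the least `n` such that `s = j / 3 ^ n` for
some `j`. -/
noncomputable def levelOf (s : ℝ) : ℕ := sInf {n : ℕ | ∃ j : ℕ, s = spikeBase n j}

/-- The index `j` of the spike at the abscissa `s = j / 3 ^ n`, where `n` is its level. -/
noncomputable def indexOf (s : ℝ) : ℕ := ⌊s * 3 ^ levelOf s⌋₊

open Classical in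
/-- The map `f`, given on the whole plane by the formulas that matter on the comb. -/
noncomputable def combMapAux (p : ℝ × ℝ) : ℝ × ℝ :=
  if p.2 = 0 then p
  else if p.2 ≤ 2 / 3 * spikeHeight (levelOf p.1) then
    (lowerPart (levelOf p.1) (indexOf p.1) p.2, 0)
  else
    (lowerPart (levelOf p.1) (indexOf p.1) (2 / 3 * spikeHeight (levelOf p.1)),
      upperPart (levelOf p.1) (indexOf p.1) p.2)

theorem spikeHeight_pos (n : ℕ) : 0 < spikeHeight n := by unfold spikeHeight; positivity

theorem levelOf_spikeBase {n j : ℕ} (hj : j ∈ spikeIndices n) : levelOf (spikeBase n j) = n := by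
  unfold levelOf
  apply le_antisymm
  · exact Nat.sInf_le ⟨j, rfl⟩
  · refine le_csInf ⟨n, j, rfl⟩ ?_
    rintro m ⟨i, hi⟩
    by_contra! hlt
    apply hj.2.2
    unfold spikeBase at hi
    rw [div_eq_div_iff (by positivity) (by positivity)] at hi
    have hi' : j * 3 ^ m = i * 3 ^ n := by exact_mod_cast hi
    obtain ⟨k, rfl⟩ := Nat.exists_eq_add_of_lt hlt
    have h3 : j * 3 ^ m = (i * 3 ^ k * 3) * 3 ^ m := by rw [hi']; ring
    have := Nat.eq_of_mul_eq_mul_right (by positivity) h3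
    exact ⟨i * 3 ^ k, by rw [this]; ring⟩

theorem indexOf_spikeBase {n j : ℕ} (hj : j ∈ spikeIndices n) : indexOf (spikeBase n j) = j := by
  unfold indexOf
  rw [levelOf_spikeBase hj]
  unfold spikeBase
  rw [div_mul_cancel₀ _ (by positivity)]
  exact Nat.floor_natCast j

theorem combMapAux_base (s : ℝ) : combMapAux (s, 0) = (s, 0) := by simp [combMapAux]

theorem combMapAux_lower {n j : ℕ} (hj : j ∈ spikeIndices n) {t : ℝ} (h0 : 0 < t)
    (ht : t ≤ 2 / 3 * spikeHeight n) :
    combMapAux (spikeBase n j, t) = (lowerPart n j t, 0) := by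
  simp [combMapAux, levelOf_spikeBase hj, indexOf_spikeBase hj, h0.ne', ht]

theorem combMapAux_upper {n j : ℕ} (hj : j ∈ spikeIndices n) {t : ℝ}
    (ht : 2 / 3 * spikeHeight n < t) :
    combMapAux (spikeBase n j, t) =
      (lowerPart n j (2 / 3 * spikeHeight n), upperPart n j t) := by
  have h0 : t ≠ 0 := by have := spikeHeight_pos n; intro h; linarith
  simp [combMapAux, levelOf_spikeBase hj, indexOf_spikeBase hj, h0, not_le.2 ht]

theorem spikeBase_mem_Icc {n j : ℕ} (hj : j ∈ spikeIndices n) : spikeBase n j ∈ Icc (0 : ℝ) 1 := by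
  unfold spikeBase
  refine ⟨by positivity, ?_⟩
  rw [div_le_one (by positivity)]
  exact_mod_cast hj.2.1

/-- The next spike is a spike of the comb. -/
theorem exists_next {n j : ℕ} (hj : j ∈ spikeIndices n) :
    ∃ m i, n ≤ m ∧ i ∈ spikeIndices m ∧ nextBase n j = spikeBase m i ∧
      nextHeight n j = spikeHeight m := by
  obtain ⟨h1, h2, h3⟩ := hj
  have hp : ∀ k : ℕ, 1 ≤ k → 3 ∣ 3 ^ k := fun k hk => dvd_pow_self 3 (by omega)
  have hq : 3 ∣ 3 ^ (n + 1) := hp _ (by omega)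
  have hq0 : 0 < 3 ^ (n + 1) := by positivity
  have hp0 : 0 < 3 ^ n := by positivity
  rcases Nat.even_or_odd n with he | ho
  · have hno : ¬ Odd n := by simpa using he
    by_cases hj1 : j = 1
    · refine ⟨n + 1, 1, by omega, ⟨le_rfl, by omega, by omega⟩, ?_, ?_⟩
      · simp [nextBase, hno, hj1]
      · simp [nextHeight, IsLastSpike, he, hj1]
    · have hh : nextHeight n j = spikeHeight n := by simp [nextHeight, IsLastSpike, hno, hj1]
      by_cases hm : j % 3 = 2
      · refine ⟨n, j - 1, le_rfl, ⟨by omega, by omega, by omega⟩, ?_, hh⟩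
        simp [nextBase, hno, hj1, hm]
      · refine ⟨n, j - 2, le_rfl, ⟨by omega, by omega, by omega⟩, ?_, hh⟩
        simp [nextBase, hno, hj1, hm]
  · have hne : ¬ Even n := by simpa using ho
    have hpn := hp n ho.pos
    by_cases hj1 : j = 3 ^ n - 1
    · refine ⟨n + 1, 3 ^ (n + 1) - 1, by omega, ⟨by omega, by omega, by omega⟩, ?_, ?_⟩
      · simp [nextBase, ho, hj1]
      · simp [nextHeight, IsLastSpike, ho, hj1]
    · have hh : nextHeight n j = spikeHeight n := by simp [nextHeight, IsLastSpike, hne, hj1]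
      by_cases hm : j % 3 = 1
      · refine ⟨n, j + 1, le_rfl, ⟨by omega, by omega, by omega⟩, ?_, hh⟩
        simp [nextBase, ho, hj1, hm]
      · refine ⟨n, j + 2, le_rfl, ⟨by omega, by omega, by omega⟩, ?_, hh⟩
        simp [nextBase, ho, hj1, hm]

theorem spike_mem_comb {n j : ℕ} (hn : 1 ≤ n) (hj : j ∈ spikeIndices n) {t : ℝ}
    (ht : t ∈ Icc 0 (spikeHeight n)) : (spikeBase n j, t) ∈ comb :=
  Or.inr (mem_biUnion (show n ∈ {n : ℕ | 1 ≤ n} from hn) ⟨⟨j, hj, rfl⟩, ht⟩)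

theorem base_mem_comb {s : ℝ} (hs : s ∈ Icc (0 : ℝ) 1) : (s, (0 : ℝ)) ∈ comb :=
  Or.inl ⟨hs, rfl⟩

/-- The map sends the comb into itself. -/
theorem mapsTo_combMapAux : MapsTo combMapAux comb comb := by
  rintro ⟨s, t⟩ (⟨hs, ht⟩ | hp)
  · obtain rfl : t = 0 := ht
    rw [combMapAux_base]
    exact base_mem_comb hs
  · simp only [mem_iUnion, mem_ofPred_eq, exists_prop] at hp
    obtain ⟨n, hn, ⟨j, hj, rfl⟩, h0, h1⟩ := hp
    dsimp only at h0 h1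
    obtain ⟨m, i, hnm, hi, hb, hh⟩ := exists_next hj
    have hpos := spikeHeight_pos n
    rcases h0.eq_or_lt with rfl | h0
    · rw [combMapAux_base]
      exact base_mem_comb (spikeBase_mem_Icc hj)
    rcases le_or_gt t (2 / 3 * spikeHeight n) with ht | ht
    · rw [combMapAux_lower hj h0 ht]
      apply base_mem_comb
      have hx := spikeBase_mem_Icc hj
      have hy := spikeBase_mem_Icc hi
      have hr0 : 0 ≤ t / (2 / 3 * spikeHeight n) := by positivity
      have hr1 : t / (2 / 3 * spikeHeight n) ≤ 1 := (div_le_one (by positivity)).2 ht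
      have := (convex_Icc (0 : ℝ) 1) hx hy (sub_nonneg.2 hr1) hr0 (by ring)
      convert this using 1
      simp only [lowerPart, hb, smul_eq_mul]
      ring
    · rw [combMapAux_upper hj ht]
      have he : lowerPart n j (2 / 3 * spikeHeight n) = spikeBase m i := by
        rw [lowerPart, div_self (by positivity), hb]; ring
      rw [he]
      apply spike_mem_comb (hn.trans hnm) hi
      have hr0 : 0 ≤ (t - 2 / 3 * spikeHeight n) / (spikeHeight n - 2 / 3 * spikeHeight n) :=
        div_nonneg (by linarith) (by linarith)
      have hr1 : (t - 2 / 3 * spikeHeight n) / (spikeHeight n - 2 / 3 * spikeHeight n) ≤ 1 :=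
        (div_le_one (by linarith)).2 (by linarith)
      have hm := spikeHeight_pos m
      rw [upperPart, hh]
      exact ⟨by positivity, by nlinarith⟩

/-- The map `f` on the comb. -/
noncomputable def combMap : comb → comb := mapsTo_combMapAux.restrict combMapAux comb comb

/-- The point `(1, 0)`. -/
def rightEnd : comb := ⟨(1, 0), base_mem_comb ⟨zero_le_one, le_rfl⟩⟩

/-- The point `(1/3, 1/3)`. -/
noncomputable def firstTip : comb := ⟨(1 / 3, 1 / 3), by
  have h := spike_mem_comb (n := 1) (j := 1) le_rfl ⟨le_rfl, by norm_num, by norm_num⟩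
    (t := 1 / 3) ⟨by norm_num, by norm_num [spikeHeight]⟩
  simpa [spikeBase] using h⟩

end DistChaos

open DistChaos

namespace DistChaos

/-! Base points are fixed. On a spike, the relative distance to the tip triples at each step
(`iterate_below_tip`), so every point other than a tip reaches the base in finite time and stays
there. The tips form a single forward orbit, `sweepPoint N` for `N ≥ 1` (`combMapAux_sweepPoint`,
`exists_sweepPoint_eq`), which sweeps odd levels from left to right and even levels from right to
left. Only three kinds of pairs remain.

Two points that end on the base are eventually at constant distance. Two tips lie on the same orbit
with a fixed lag. A step moves a point by at most three times its height (`dist_combMapAux_le`) and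
heights along the orbit tend to 0, so the pair is asymptotic. For a point that ends at `(s, 0)` and
a tip, each sweep crosses the interval of radius `δ` about `s` at a steady rate, so the visits have
upper frequency at most `10 * δ` (`count_visits_le`). Hence the upper distribution function tends to
0 at 0. In no case is the pair DC2 or DC2½.

The DC3 pair comes from the alternating direction: the end of one sweep and the start of the next
are spent on the same side, and sweep lengths grow by a factor 3. At times about `15 * 3 ^ m` the
orbit has spent the last 8/15 of its time in the right third for odd `m`, in the left third for even
`m` (`sweepPoint_third`), so the frequency of closeness to `(1, 0)` oscillates.

The comb contains no circle because an interior point of a spike cuts it, whereas a circle minus a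
point is connected. -/

/-! ### Counting solutions of a predicate -/

theorem sub_le_count {p : ℕ → Prop} [DecidablePred p] {a b : ℕ}
    (h : ∀ k, a ≤ k → k < b → p k) : b - a ≤ Nat.count p b := by
  rcases le_total b a with hab | hab
  · omega
  · obtain ⟨c, rfl⟩ := Nat.exists_eq_add_of_le hab
    have : Nat.count (fun k => p (a + k)) c = c :=
      Nat.count_iff_forall.2 fun k hk => h _ (by omega) (by omega)
    rw [Nat.count_add, this]
    omega

theorem count_le_of_forall_not {p : ℕ → Prop} [DecidablePred p] {a b : ℕ}
    (h : ∀ k, a ≤ k → k < b → ¬ p k) : Nat.count p b ≤ a := by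
  rcases le_total b a with hab | hab
  · exact (Nat.count_le p).trans hab
  · obtain ⟨c, rfl⟩ := Nat.exists_eq_add_of_le hab
    have : Nat.count (fun k => p (a + k)) c = 0 :=
      Nat.count_iff_forall_not.2 fun k hk => h _ (by omega) (by omega)
    rw [Nat.count_add, this]
    exact Nat.count_le p

/-- A predicate whose solutions are pairwise at distance less than `D` has at most `D + 1`
solutions. -/
theorem count_le_of_sub_lt {p : ℕ → Prop} [DecidablePred p] {b : ℕ} {D : ℝ} (hD : 0 ≤ D)
    (h : ∀ i k, i ≤ k → k < b → p i → p k → (k : ℝ) - i < D) :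
    (Nat.count p b : ℝ) ≤ D + 1 := by
  by_cases hex : ∃ i, i < b ∧ p i
  · classical
    set i := Nat.find hex
    obtain ⟨hib, hi⟩ := Nat.find_spec hex
    have hsub : (Finset.range b).filter p ⊆ Finset.Icc i (i + ⌊D⌋₊) := by
      intro k hk
      rw [Finset.mem_filter, Finset.mem_range] at hk
      have hik : i ≤ k := Nat.find_min' hex hk
      have := h i k hik hk.1 hi hk.2
      rw [Finset.mem_Icc]
      refine ⟨hik, ?_⟩
      have h2 : k - i ≤ ⌊D⌋₊ := Nat.le_floor (by rw [Nat.cast_sub hik]; exact this.le)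
      omega
    have hc := Finset.card_le_card hsub
    rw [← Nat.count_eq_card_filter_range, Nat.card_Icc] at hc
    have h1 : Nat.count p b ≤ ⌊D⌋₊ + 1 := by omega
    calc (Nat.count p b : ℝ) ≤ ⌊D⌋₊ + 1 := by exact_mod_cast h1
      _ ≤ D + 1 := by gcongr; exact Nat.floor_le hD
  · have : Nat.count p b = 0 := Nat.count_iff_forall_not.2 fun k hk hpk => hex ⟨k, hk, hpk⟩
    rw [this]
    push_cast
    linarith

/-! ### Distribution functions from counts and from asymptotic behaviour -/

section Freq

variable {X : Type*} [MetricSpace X] {f : X → X} {x y : X} {δ : ℝ}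

theorem closeFreq_eq_count (f : X → X) (x y : X) (δ : ℝ) (n : ℕ) :
    closeFreq f x y δ n =
      (Nat.count (fun k => dist (f^[k] x) (f^[k] y) < δ) (n + 1) : ℝ) / n := by
  have : {k : ℕ | k ≤ n ∧ dist (f^[k] x) (f^[k] y) < δ} =
      ((Finset.range (n + 1)).filter fun k => dist (f^[k] x) (f^[k] y) < δ : Finset ℕ) := by
    ext k
    simp
  rw [closeFreq, this, Set.ncard_coe_finset, Nat.count_eq_card_filter_range, one_div,
    inv_mul_eq_div]

theorem tendsto_closeFreq_one (h : ∀ᶠ k in atTop, dist (f^[k] x) (f^[k] y) < δ) :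
    Tendsto (closeFreq f x y δ) atTop (𝓝 1) := by
  obtain ⟨a, ha⟩ := eventually_atTop.1 h
  -- The definition counts `n + 1` instants but divides by `n`; the frequency lies between `(n + 1 -
  -- a) / n` and `(n + 1) / n`.
  have hlow : Tendsto (fun n : ℕ => 1 + (1 - (a : ℝ)) / n) atTop (𝓝 1) := by
    simpa using (tendsto_const_div_atTop_nhds_zero_nat (1 - (a : ℝ))).const_add 1
  have hup : Tendsto (fun n : ℕ => 1 + (1 : ℝ) / n) atTop (𝓝 1) := by
    simpa using (tendsto_const_div_atTop_nhds_zero_nat (1 : ℝ)).const_add 1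
  refine tendsto_of_tendsto_of_tendsto_of_le_of_le' hlow hup ?_ ?_
  · filter_upwards [eventually_gt_atTop 0] with n hn
    have hn' : (0 : ℝ) < n := by exact_mod_cast hn
    have hc : n + 1 - a ≤ Nat.count (fun k => dist (f^[k] x) (f^[k] y) < δ) (n + 1) :=
      sub_le_count fun k hk _ => ha k hk
    have hc' : n + 1 ≤ Nat.count (fun k => dist (f^[k] x) (f^[k] y) < δ) (n + 1) + a := by omega
    have hr : (n : ℝ) + 1 ≤ Nat.count (fun k => dist (f^[k] x) (f^[k] y) < δ) (n + 1) + a := by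
      exact_mod_cast hc'
    rw [closeFreq_eq_count, le_div_iff₀ hn', add_mul, div_mul_cancel₀ _ hn'.ne']
    linarith
  · filter_upwards [eventually_gt_atTop 0] with n hn
    have hn' : (0 : ℝ) < n := by exact_mod_cast hn
    have hr : (Nat.count (fun k => dist (f^[k] x) (f^[k] y) < δ) (n + 1) : ℝ) ≤ n + 1 := by
      exact_mod_cast Nat.count_le _
    rw [closeFreq_eq_count, div_le_iff₀ hn', add_mul, div_mul_cancel₀ _ hn'.ne']
    linarith

/-- The additive constant `K` disappears after division by `n`; only the slope `c` matters. -/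
theorem upperDist_le_of_count_le {K c : ℝ}
    (h : ∀ n : ℕ, (Nat.count (fun k => dist (f^[k] x) (f^[k] y) < δ) (n + 1) : ℝ) ≤ K + c * n) :
    upperDist f x y δ ≤ c := by
  have hlim : Tendsto (fun n : ℕ => K / n + c) atTop (𝓝 c) := by
    simpa using (tendsto_const_div_atTop_nhds_zero_nat K).add_const c
  rw [← hlim.limsup_eq]
  refine limsup_le_limsup ?_ (isBoundedUnder_ge_closeFreq f x y δ).isCoboundedUnder_le
    hlim.isBoundedUnder_le
  filter_upwards [eventually_gt_atTop 0] with n hn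
  have hn' : (0 : ℝ) < n := by exact_mod_cast hn
  rw [closeFreq_eq_count, div_le_iff₀ hn', add_mul, div_mul_cancel₀ _ hn'.ne']
  exact h n

theorem lowerDist_nonneg (f : X → X) (x y : X) (δ : ℝ) : 0 ≤ lowerDist f x y δ :=
  le_liminf_of_le (isBoundedUnder_le_closeFreq f x y δ).isCoboundedUnder_ge
    (Eventually.of_forall (closeFreq_nonneg f x y δ))

theorem lowerDist_le_upperDist (f : X → X) (x y : X) (δ : ℝ) :
    lowerDist f x y δ ≤ upperDist f x y δ :=
  liminf_le_limsup (isBoundedUnder_le_closeFreq f x y δ) (isBoundedUnder_ge_closeFreq f x y δ)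

theorem closeFreq_comm (f : X → X) (x y : X) (δ : ℝ) (n : ℕ) :
    closeFreq f x y δ n = closeFreq f y x δ n := by
  simp only [closeFreq, dist_comm]

theorem upperDist_comm (f : X → X) (x y : X) : upperDist f x y = upperDist f y x := by
  ext δ
  simp only [upperDist, closeFreq_comm f x y]

/-- Both distribution functions are identically 1 for positive `δ`, hence also in the limit at 0. -/
theorem not_scrambled_of_asymptotic
    (h : Tendsto (fun k => dist (f^[k] x) (f^[k] y)) atTop (𝓝 0)) :
    ¬ IsDC2Pair f x y ∧ ¬ IsDC2HalfPair f x y := by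
  have hev : ∀ δ, 0 < δ → Tendsto (closeFreq f x y δ) atTop (𝓝 1) := fun δ hδ =>
    tendsto_closeFreq_one (h.eventually (gt_mem_nhds hδ))
  have hl : ∀ δ, 0 < δ → lowerDist f x y δ = 1 := fun δ hδ => (hev δ hδ).liminf_eq
  have hu : ∀ δ, 0 < δ → upperDist f x y δ = 1 := fun δ hδ => (hev δ hδ).limsup_eq
  constructor
  · rintro ⟨-, ε, hε, -, hlt⟩
    exact hlt.ne (hl ε hε)
  · intro hlt
    have hl0 : lowerDistZero f x y = 1 := tendsto_nhds_unique (tendsto_lowerDistZero f x y)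
      (tendsto_const_nhds.congr' (eventually_nhdsWithin_of_forall fun δ hδ => (hl δ hδ).symm))
    have hu0 : upperDistZero f x y = 1 := tendsto_nhds_unique (tendsto_upperDistZero f x y)
      (tendsto_const_nhds.congr' (eventually_nhdsWithin_of_forall fun δ hδ => (hu δ hδ).symm))
    rw [IsDC2HalfPair, hl0, hu0] at hlt
    exact lt_irrefl _ hlt

/-- DC2 fails at some small `δ`, which is admissible because the diameter is positive. DC2½ fails
because the lower function is nonnegative and the upper one has limit 0. -/
theorem not_scrambled_of_tendsto_upperDist (hd : 0 < Metric.diam (univ : Set X))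
    (h : Tendsto (upperDist f x y) (𝓝[>] 0) (𝓝 0)) :
    ¬ IsDC2Pair f x y ∧ ¬ IsDC2HalfPair f x y := by
  constructor
  · rintro ⟨h1, -⟩
    have hlt : ∀ᶠ δ in 𝓝[>] (0 : ℝ), upperDist f x y δ < 1 :=
      h.eventually (gt_mem_nhds zero_lt_one)
    obtain ⟨δ, hδ, h0, hle⟩ := (hlt.and (Ioc_mem_nhdsGT hd)).exists
    exact hδ.ne (h1 δ h0 hle)
  · intro hlt
    have hu0 : upperDistZero f x y = 0 := tendsto_nhds_unique (tendsto_upperDistZero f x y) h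
    have hl0 : 0 ≤ lowerDistZero f x y :=
      ge_of_tendsto' (tendsto_lowerDistZero f x y) (lowerDist_nonneg f x y)
    rw [IsDC2HalfPair, hu0] at hlt
    exact hlt.not_ge hl0

theorem tendsto_upperDist_zero {c C : ℝ} (hc : 0 < c)
    (h : ∀ δ, 0 < δ → δ < c → upperDist f x y δ ≤ C * δ) :
    Tendsto (upperDist f x y) (𝓝[>] 0) (𝓝 0) := by
  have hC : Tendsto (fun δ : ℝ => C * δ) (𝓝[>] 0) (𝓝 0) := by
    have : Tendsto (fun δ : ℝ => C * δ) (𝓝 0) (𝓝 (C * 0)) := tendsto_id.const_mul C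
    rw [mul_zero] at this
    exact this.mono_left nhdsWithin_le_nhds
  refine tendsto_of_tendsto_of_tendsto_of_le_of_le' tendsto_const_nhds hC
    (Eventually.of_forall fun δ => (lowerDist_nonneg f x y δ).trans
      (lowerDist_le_upperDist f x y δ)) ?_
  filter_upwards [Ioo_mem_nhdsGT hc] with δ hδ using h δ hδ.1 hδ.2

theorem tendsto_upperDist_zero_of_le_dist {c : ℝ} (hc : 0 < c)
    (h : ∀ᶠ k in atTop, c ≤ dist (f^[k] x) (f^[k] y)) :
    Tendsto (upperDist f x y) (𝓝[>] 0) (𝓝 0) := by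
  obtain ⟨a, ha⟩ := eventually_atTop.1 h
  refine tendsto_upperDist_zero (C := 0) hc fun δ _ hδ => ?_
  rw [zero_mul]
  refine upperDist_le_of_count_le (K := a) fun n => ?_
  rw [zero_mul, add_zero]
  exact_mod_cast count_le_of_forall_not fun k hk _ => not_lt.2 (hδ.le.trans (ha k hk))

end Freq

/-! ### The map along the spikes -/

theorem spikeHeight_succ (n : ℕ) : spikeHeight (n + 1) = spikeHeight n / 3 := by
  simp only [spikeHeight, pow_succ]
  field_simp

theorem spikeBase_eq (n j : ℕ) : spikeBase n j = j * spikeHeight n := by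
  simp only [spikeBase, spikeHeight]
  ring

theorem pow_mul_spikeHeight (n : ℕ) : (3 : ℝ) ^ n * spikeHeight n = 1 := by
  simp only [spikeHeight]
  field_simp

theorem spikeHeight_anti {m n : ℕ} (h : n ≤ m) : spikeHeight m ≤ spikeHeight n := by
  unfold spikeHeight
  gcongr
  norm_num

/-- A point of the comb is a base point or a point of a spike above its base. -/
theorem mem_comb_cases {p : ℝ × ℝ} (hp : p ∈ comb) :
    (∃ s ∈ Icc (0 : ℝ) 1, p = (s, 0)) ∨
      ∃ n j t, 1 ≤ n ∧ j ∈ spikeIndices n ∧ 0 < t ∧ t ≤ spikeHeight n ∧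
        p = (spikeBase n j, t) := by
  obtain ⟨s, t⟩ := p
  rcases hp with ⟨hs, ht⟩ | hp
  · obtain rfl : t = 0 := ht
    exact Or.inl ⟨s, hs, rfl⟩
  · simp only [mem_iUnion, mem_ofPred_eq, exists_prop] at hp
    obtain ⟨n, hn, ⟨j, hj, rfl⟩, h0, h1⟩ := hp
    dsimp only at h0 h1
    rcases h0.eq_or_lt with rfl | h0
    · exact Or.inl ⟨_, spikeBase_mem_Icc hj, rfl⟩
    · exact Or.inr ⟨n, j, t, hn, hj, h0, h1, rfl⟩

theorem abs_nextBase_sub_le {n j : ℕ} (hj : j ∈ spikeIndices n) :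
    |nextBase n j - spikeBase n j| ≤ 2 * spikeHeight n := by
  obtain ⟨h1, h2, h3⟩ := hj
  have hpos := spikeHeight_pos n
  have hmul := pow_mul_spikeHeight n
  have h1' : 1 ≤ 3 ^ (n + 1) := Nat.one_le_pow _ _ (by norm_num)
  have h1'' : 1 ≤ 3 ^ n := Nat.one_le_pow _ _ (by norm_num)
  unfold nextBase
  split_ifs with hn hl hm hl hm <;> simp only [spikeBase_eq, spikeHeight_succ]
  · subst hl
    push_cast [Nat.cast_sub h1', Nat.cast_sub h1'']
    rw [pow_succ, abs_le]
    constructor <;> nlinarith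
  · push_cast
    rw [abs_le]
    constructor <;> nlinarith
  · push_cast
    rw [abs_le]
    constructor <;> nlinarith
  · subst hl
    push_cast
    rw [abs_le]
    constructor <;> nlinarith
  · push_cast [Nat.cast_sub h1]
    rw [abs_le]
    constructor <;> nlinarith
  · push_cast [Nat.cast_sub (show 2 ≤ j by omega)]
    rw [abs_le]
    constructor <;> nlinarith

/-- On a spike, the map is given by one continuous formula. -/
theorem combMapAux_spike {n j : ℕ} (hj : j ∈ spikeIndices n) {t : ℝ} (h0 : 0 ≤ t) :
    combMapAux (spikeBase n j, t) =
      (lowerPart n j (min t (2 / 3 * spikeHeight n)), max 0 (upperPart n j t)) := by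
  have hpos := spikeHeight_pos n
  obtain ⟨m, i, -, -, -, hh⟩ := exists_next hj
  have hnext : 0 < nextHeight n j := hh ▸ spikeHeight_pos m
  rcases le_or_gt t (2 / 3 * spikeHeight n) with ht | ht
  · have hup : upperPart n j t ≤ 0 := by
      unfold upperPart
      exact mul_nonpos_of_nonpos_of_nonneg
        (div_nonpos_of_nonpos_of_nonneg (by linarith) (by linarith)) hnext.le
    rw [min_eq_left ht, max_eq_left hup]
    rcases h0.eq_or_lt with rfl | h0
    · rw [combMapAux_base]
      simp [lowerPart]
    · exact combMapAux_lower hj h0 ht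
  · have hup : 0 ≤ upperPart n j t := by
      unfold upperPart
      exact mul_nonneg (div_nonneg (by linarith) (by linarith)) hnext.le
    rw [min_eq_right ht.le, max_eq_right hup]
    exact combMapAux_upper hj ht

/-- Horizontally, the fraction `u / (2/3 h)` of a displacement of at most `2 h` is at most `3 u`.
Vertically, `upperPart` has slope at most 3 and vanishes at `2/3 h`, so it stays below the diagonal
up to `h`. The bound serves twice: for continuity at the base and for the slowness of the orbit of
the tips. -/
theorem dist_combMapAux_le {p : ℝ × ℝ} (hp : p ∈ comb) : dist (combMapAux p) p ≤ 3 * p.2 := by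
  rcases mem_comb_cases hp with ⟨s, hs, rfl⟩ | ⟨n, j, t, hn, hj, h0, h1, rfl⟩
  · simp [combMapAux_base]
  · have hpos := spikeHeight_pos n
    obtain ⟨m, i, hnm, -, -, hh⟩ := exists_next hj
    have hnext : 0 < nextHeight n j := hh ▸ spikeHeight_pos m
    have hnext' : nextHeight n j ≤ spikeHeight n := hh ▸ spikeHeight_anti hnm
    have hD := abs_nextBase_sub_le hj
    rw [combMapAux_spike hj h0.le, Prod.dist_eq]
    refine max_le ?_ ?_
    · set u := min t (2 / 3 * spikeHeight n) with hu
      have hu0 : 0 ≤ u := le_min h0.le (by positivity)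
      have hut : u ≤ t := min_le_left _ _
      simp only [Real.dist_eq, lowerPart, add_sub_cancel_left]
      rw [abs_mul, abs_of_nonneg (by positivity)]
      calc u / (2 / 3 * spikeHeight n) * |nextBase n j - spikeBase n j|
          ≤ u / (2 / 3 * spikeHeight n) * (2 * spikeHeight n) := by gcongr
        _ = 3 * u := by field_simp
        _ ≤ 3 * t := by linarith
    · have hup : upperPart n j t ≤ t := by
        have he : upperPart n j t =
            (t - 2 / 3 * spikeHeight n) * (nextHeight n j / (spikeHeight n / 3)) := by
          unfold upperPart
          rw [show spikeHeight n - 2 / 3 * spikeHeight n = spikeHeight n / 3 by ring]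
          ring
        rcases le_or_gt t (2 / 3 * spikeHeight n) with ht | ht
        · rw [he]
          refine le_trans (mul_nonpos_of_nonpos_of_nonneg (by linarith) (by positivity)) h0.le
        · rw [he]
          have : nextHeight n j / (spikeHeight n / 3) ≤ 3 := by
            rw [div_le_iff₀ (by positivity)]; linarith
          nlinarith
      simp only [Real.dist_eq]
      have h2 : max 0 (upperPart n j t) ≤ t := max_le h0.le hup
      have h3 : 0 ≤ max 0 (upperPart n j t) := le_max_left _ _
      rw [abs_le]
      constructor <;> linarith

theorem coe_combMap (p : comb) : (combMap p : ℝ × ℝ) = combMapAux p := rfl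

theorem coe_combMap_iterate (k : ℕ) (p : comb) :
    ((combMap^[k] p : comb) : ℝ × ℝ) = combMapAux^[k] p := by
  induction k generalizing p with
  | zero => rfl
  | succ k ih => rw [Function.iterate_succ_apply, Function.iterate_succ_apply, ih, coe_combMap]

theorem iterate_base (k : ℕ) (s : ℝ) : combMapAux^[k] (s, 0) = (s, 0) :=
  Function.iterate_fixed (combMapAux_base s) k

theorem combMapAux_tip {n j : ℕ} (hj : j ∈ spikeIndices n) :
    combMapAux (spikeBase n j, spikeHeight n) = (nextBase n j, nextHeight n j) := by
  have hpos := spikeHeight_pos n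
  rw [combMapAux_upper hj (by linarith), lowerPart, upperPart, div_self (by positivity),
    div_self (by linarith)]
  ring_nf

/-- Below the tip of a spike, the relative distance to the tip triples at each step, until the
orbit reaches the base. -/
theorem iterate_below_tip (k : ℕ) {n j : ℕ} (hj : j ∈ spikeIndices n) {t : ℝ}
    (h0 : 0 ≤ t) (h1 : t ≤ (1 - 1 / 3 ^ k) * spikeHeight n) :
    ∃ s, combMapAux^[k] (spikeBase n j, t) = (s, 0) := by
  induction k generalizing n j t with
  | zero =>
    have : t = 0 := le_antisymm (by simpa using h1) h0
    exact ⟨_, by rw [this]; rfl⟩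
  | succ k ih =>
    rw [Function.iterate_succ_apply]
    have hpos := spikeHeight_pos n
    rcases h0.eq_or_lt with rfl | h0
    · exact ⟨_, by rw [combMapAux_base, iterate_base]⟩
    rcases le_or_gt t (2 / 3 * spikeHeight n) with ht | ht
    · exact ⟨_, by rw [combMapAux_lower hj h0 ht, iterate_base]⟩
    · obtain ⟨m, i, -, hi, hb, hh⟩ := exists_next hj
      have he : lowerPart n j (2 / 3 * spikeHeight n) = spikeBase m i := by
        rw [lowerPart, div_self (by positivity), hb]; ring
      have hm := spikeHeight_pos m
      rw [combMapAux_upper hj ht, he]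
      -- With `r = t / h`, the new relative height is `3 * r - 2`, so `1 - r` is multiplied by 3.
      have hr : (t - 2 / 3 * spikeHeight n) / (spikeHeight n - 2 / 3 * spikeHeight n) ≤
          1 - 1 / 3 ^ k := by
        rw [div_le_iff₀ (by linarith)]
        have : (1 : ℝ) / 3 ^ (k + 1) = 1 / 3 ^ k / 3 := by rw [pow_succ]; field_simp
        rw [this] at h1
        linarith
      refine ih hi ?_ ?_
      · rw [upperPart, hh]
        exact mul_nonneg (div_nonneg (by linarith) (by linarith)) hm.le
      · rw [upperPart, hh]
        gcongr

/-- The orbit of a point that is not a tip ends in a fixed point on the base. -/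
theorem eventually_base_or_tip (p : comb) :
    (∃ k s, combMapAux^[k] (p : ℝ × ℝ) = (s, 0)) ∨
      ∃ n j, 1 ≤ n ∧ j ∈ spikeIndices n ∧ (p : ℝ × ℝ) = (spikeBase n j, spikeHeight n) := by
  rcases mem_comb_cases p.2 with ⟨s, hs, hp⟩ | ⟨n, j, t, hn, hj, h0, h1, hp⟩
  · exact Or.inl ⟨0, s, hp⟩
  rcases h1.eq_or_lt with rfl | h1
  · exact Or.inr ⟨n, j, hn, hj, hp⟩
  have hpos := spikeHeight_pos n
  have hr : 0 < 1 - t / spikeHeight n := by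
    rw [sub_pos, div_lt_one hpos]
    exact h1
  obtain ⟨k, hk⟩ := exists_pow_lt_of_lt_one hr (show (1 / 3 : ℝ) < 1 by norm_num)
  obtain ⟨s, hs⟩ := iterate_below_tip k hj h0.le (t := t) (by
    rw [← div_le_iff₀ hpos]
    rw [one_div, inv_pow, ← one_div] at hk
    linarith)
  exact Or.inl ⟨k, s, by rw [hp, hs]⟩

/-! ### The orbit of the tips -/

/-- The index of the `i`-th spike of level `n + 1` visited by the orbit of the tips. -/
def sweepIndex (n i : ℕ) : ℕ :=
  if Even n then i + i / 2 + 1 else 3 ^ (n + 1) - (i + i / 2 + 1)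

/-- The orbit of the tips, started at time `1`: level `n + 1` is visited at the times
`3 ^ n, …, 3 ^ (n + 1) - 1`. -/
noncomputable def sweepPoint (N : ℕ) : ℝ × ℝ :=
  (spikeBase (Nat.log 3 N + 1) (sweepIndex (Nat.log 3 N) (N - 3 ^ Nat.log 3 N)),
    spikeHeight (Nat.log 3 N + 1))

theorem exists_eq_pow_add {N : ℕ} (hN : 1 ≤ N) : ∃ n i, i < 2 * 3 ^ n ∧ N = 3 ^ n + i := by
  have h1 := Nat.pow_log_le_self 3 (x := N) (by omega)
  have h2 := Nat.lt_pow_succ_log_self (b := 3) (by norm_num) N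
  rw [pow_succ] at h2
  exact ⟨Nat.log 3 N, N - 3 ^ Nat.log 3 N, by omega, by omega⟩

theorem sweepPoint_pow_add {n i : ℕ} (hi : i < 2 * 3 ^ n) :
    sweepPoint (3 ^ n + i) = (spikeBase (n + 1) (sweepIndex n i), spikeHeight (n + 1)) := by
  have : Nat.log 3 (3 ^ n + i) = n :=
    Nat.log_eq_of_pow_le_of_lt_pow (by omega) (by rw [pow_succ]; omega)
  rw [sweepPoint, this, Nat.add_sub_cancel_left]

/-- The numbers `i + i / 2 + 1` are 1, 2, 4, 5, 7, 8, …, the non-multiples of 3; subtraction from `3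
^ (n + 1)` reverses their order. -/
theorem sweepIndex_mem {n i : ℕ} (hi : i < 2 * 3 ^ n) : sweepIndex n i ∈ spikeIndices (n + 1) := by
  unfold sweepIndex spikeIndices
  rw [pow_succ]
  split_ifs <;> refine ⟨?_, ?_, ?_⟩ <;> omega

theorem exists_sweepIndex_eq {n j : ℕ} (hj : j ∈ spikeIndices (n + 1)) :
    ∃ i, i < 2 * 3 ^ n ∧ sweepIndex n i = j := by
  obtain ⟨h1, h2, h3⟩ := hj
  unfold sweepIndex
  rw [pow_succ] at *
  split_ifs
  · exact ⟨j - j / 3 - 1, by omega, by omega⟩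
  · exact ⟨(3 ^ n * 3 - j) - (3 ^ n * 3 - j) / 3 - 1, by omega, by omega⟩

theorem exists_sweepPoint_eq {n j : ℕ} (hn : 1 ≤ n) (hj : j ∈ spikeIndices n) :
    ∃ N, 1 ≤ N ∧ sweepPoint N = (spikeBase n j, spikeHeight n) := by
  obtain ⟨n, rfl⟩ := Nat.exists_eq_add_of_le' hn
  obtain ⟨i, hi, rfl⟩ := exists_sweepIndex_eq hj
  exact ⟨3 ^ n + i, by have := Nat.one_le_pow n 3 (by norm_num); omega, sweepPoint_pow_add hi⟩

theorem sweepPoint_mem {N : ℕ} (hN : 1 ≤ N) : sweepPoint N ∈ comb := by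
  obtain ⟨n, i, hi, rfl⟩ := exists_eq_pow_add hN
  rw [sweepPoint_pow_add hi]
  exact spike_mem_comb (by omega) (sweepIndex_mem hi) ⟨(spikeHeight_pos _).le, le_rfl⟩

theorem combMapAux_sweepPoint {N : ℕ} (hN : 1 ≤ N) :
    combMapAux (sweepPoint N) = sweepPoint (N + 1) := by
  obtain ⟨n, i, hi, rfl⟩ := exists_eq_pow_add hN
  have hj := sweepIndex_mem hi
  have hpow : 0 < 3 ^ n := by positivity
  rw [sweepPoint_pow_add hi, combMapAux_tip hj]
  have hE := Nat.even_add_one (n := n)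
  have hO := Nat.odd_add_one (n := n)
  rcases Nat.lt_or_ge (i + 1) (2 * 3 ^ n) with hi' | hi'
  · rw [add_assoc, sweepPoint_pow_add hi']
    by_cases he : Even n
    · have e1 : sweepIndex n i = i + i / 2 + 1 := by simp [sweepIndex, he]
      have e2 : sweepIndex n (i + 1) = i + 1 + (i + 1) / 2 + 1 := by simp [sweepIndex, he]
      have hne : ¬ (i + i / 2 + 1 = 3 ^ (n + 1) - 1) := by rw [pow_succ]; omega
      have hodd : Odd (n + 1) := hO.2 (by simpa using he)
      have hneven : ¬ Even (n + 1) := by simpa using hodd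
      rw [e1, e2, nextHeight, if_neg (by simp [IsLastSpike, hne, hneven])]
      rw [nextBase, if_pos hodd, if_neg hne]
      congr 1
      split_ifs <;> congr 1 <;> omega
    · have e1 : sweepIndex n i = 3 ^ (n + 1) - (i + i / 2 + 1) := by simp [sweepIndex, he]
      have e2 : sweepIndex n (i + 1) = 3 ^ (n + 1) - (i + 1 + (i + 1) / 2 + 1) := by
        simp [sweepIndex, he]
      have hne : ¬ (3 ^ (n + 1) - (i + i / 2 + 1) = 1) := by rw [pow_succ]; omega
      have heven : Even (n + 1) := hE.2 he
      have hnodd : ¬ Odd (n + 1) := by simpa using heven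
      rw [e1, e2, nextHeight, if_neg (by simp [IsLastSpike, hne, hnodd])]
      rw [nextBase, if_neg hnodd, if_neg hne, pow_succ]
      congr 1
      split_ifs <;> congr 1 <;> omega
  -- The last visit on level `n + 1`: the spike is the exceptional one, and the orbit passes to the
  -- next level, where the direction is reversed.
  · have hN' : 3 ^ n + i + 1 = 3 ^ (n + 1) + 0 := by rw [pow_succ]; omega
    have hi0 : i = 2 * 3 ^ n - 1 := by omega
    rw [hN', sweepPoint_pow_add (by positivity)]
    by_cases he : Even n
    · have hodd : Odd (n + 1) := hO.2 (by simpa using he)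
      have hneven : ¬ Even (n + 1) := by simpa using hodd
      have e1 : sweepIndex n i = 3 ^ (n + 1) - 1 := by
        simp only [sweepIndex, he, if_true, pow_succ]; omega
      have e2 : sweepIndex (n + 1) 0 = 3 ^ (n + 1 + 1) - 1 := by simp [sweepIndex, hneven]
      rw [e1, e2, nextHeight,
        if_pos (show IsLastSpike (n + 1) (3 ^ (n + 1) - 1) from Or.inl ⟨hodd, rfl⟩), nextBase,
        if_pos hodd, if_pos rfl]
    · have heven : Even (n + 1) := hE.2 he
      have hnodd : ¬ Odd (n + 1) := by simpa using heven
      have e1 : sweepIndex n i = 1 := by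
        simp only [sweepIndex, he, if_false, pow_succ]; omega
      have e2 : sweepIndex (n + 1) 0 = 1 := by simp [sweepIndex, heven]
      rw [e1, e2, nextHeight,
        if_pos (show IsLastSpike (n + 1) 1 from Or.inr ⟨heven, rfl⟩), nextBase,
        if_neg hnodd, if_pos rfl]

theorem iterate_sweepPoint (k : ℕ) {N : ℕ} (hN : 1 ≤ N) :
    combMapAux^[k] (sweepPoint N) = sweepPoint (N + k) := by
  induction k generalizing N with
  | zero => rfl
  | succ k ih =>
    rw [Function.iterate_succ_apply, combMapAux_sweepPoint hN, ih (by omega)]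
    congr 1
    omega

theorem sweepPoint_one : sweepPoint 1 = (1 / 3, 1 / 3) := by
  have := sweepPoint_pow_add (n := 0) (i := 0) (by norm_num)
  simpa [sweepIndex, spikeBase, spikeHeight] using this

theorem sweepPoint_snd_le {N : ℕ} (hN : 1 ≤ N) : (sweepPoint N).2 ≤ 1 / N := by
  have h2 : N < 3 ^ (Nat.log 3 N + 1) := Nat.lt_pow_succ_log_self (by norm_num) N
  have h3 : (N : ℝ) ≤ 3 ^ (Nat.log 3 N + 1) := by exact_mod_cast h2.le
  have : (0 : ℝ) < N := by exact_mod_cast hN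
  simp only [sweepPoint, spikeHeight]
  gcongr

/-- From time `N` on, heights are at most `1 / N`, so each of the `d` steps has length at most `3 /
N`. -/
theorem dist_sweepPoint_add_le (d : ℕ) {N : ℕ} (hN : 1 ≤ N) :
    dist (sweepPoint N) (sweepPoint (N + d)) ≤ 3 * d / N := by
  have hN' : (0 : ℝ) < N := by exact_mod_cast hN
  induction d with
  | zero => simp
  | succ d ih =>
    have hle : 1 ≤ N + d := by omega
    have h1 := dist_combMapAux_le (sweepPoint_mem hle)
    rw [combMapAux_sweepPoint hle, dist_comm] at h1
    have h2 := sweepPoint_snd_le hle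
    have h3 : (1 : ℝ) / (N + d : ℕ) ≤ 1 / N := by
      gcongr
      omega
    calc dist (sweepPoint N) (sweepPoint (N + (d + 1)))
        ≤ dist (sweepPoint N) (sweepPoint (N + d)) +
          dist (sweepPoint (N + d)) (sweepPoint (N + d + 1)) := dist_triangle _ _ _
      _ ≤ 3 * d / N + 3 * (1 / N) := by linarith
      _ = 3 * ((d + 1 : ℕ) : ℝ) / N := by push_cast; ring

theorem tendsto_dist_sweepPoint {A B : ℕ} (hA : 1 ≤ A) (hAB : A ≤ B) :
    Tendsto (fun k => dist (sweepPoint (A + k)) (sweepPoint (B + k))) atTop (𝓝 0) := by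
  obtain ⟨d, rfl⟩ := Nat.exists_eq_add_of_le hAB
  have h := tendsto_const_div_atTop_nhds_zero_nat (3 * (d : ℝ))
  refine squeeze_zero' (Eventually.of_forall fun _ => dist_nonneg) ?_ h
  filter_upwards [eventually_ge_atTop 1] with k hk
  have h1 := dist_sweepPoint_add_le d (N := A + k) (by omega)
  rw [add_right_comm A d k]
  refine h1.trans ?_
  have hk' : (0 : ℝ) < k := by exact_mod_cast hk
  gcongr
  omega

/-! ### The comb is a dendrite -/

theorem comb_snd_nonneg {p : ℝ × ℝ} (hp : p ∈ comb) : 0 ≤ p.2 := by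
  rcases mem_comb_cases hp with ⟨s, hs, rfl⟩ | ⟨n, j, t, hn, hj, h0, h1, rfl⟩
  · exact le_rfl
  · exact h0.le

theorem comb_fst_mem {p : ℝ × ℝ} (hp : p ∈ comb) : p.1 ∈ Icc (0 : ℝ) 1 := by
  rcases mem_comb_cases hp with ⟨s, hs, rfl⟩ | ⟨n, j, t, hn, hj, h0, h1, rfl⟩
  · exact hs
  · exact spikeBase_mem_Icc hj

theorem comb_snd_le_one {p : ℝ × ℝ} (hp : p ∈ comb) : p.2 ≤ 1 := by
  rcases mem_comb_cases hp with ⟨s, hs, rfl⟩ | ⟨n, j, t, hn, hj, h0, h1, rfl⟩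
  · exact zero_le_one
  · exact h1.trans ((spikeHeight_anti (Nat.zero_le n)).trans (by norm_num [spikeHeight]))

/-- The comb is closed under moving points down. -/
theorem comb_down {x y t : ℝ} (hp : (x, y) ∈ comb) (h0 : 0 ≤ t) (ht : t ≤ y) : (x, t) ∈ comb := by
  rcases mem_comb_cases hp with ⟨s, hs, h⟩ | ⟨n, j, u, hn, hj, hu, h1, h⟩
  · rw [Prod.mk.injEq] at h
    obtain ⟨rfl, rfl⟩ := h
    rw [le_antisymm ht h0]
    exact base_mem_comb hs
  · rw [Prod.mk.injEq] at h
    obtain ⟨rfl, rfl⟩ := h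
    exact spike_mem_comb hn hj ⟨h0, ht.trans h1⟩

theorem exists_spikeHeight_lt {c : ℝ} (hc : 0 < c) : ∃ N, spikeHeight N < c := by
  obtain ⟨N, hN⟩ := exists_pow_lt_of_lt_one hc (show (1 / 3 : ℝ) < 1 by norm_num)
  exact ⟨N, by rwa [one_div, inv_pow, ← one_div] at hN⟩

/-- Points above the height of the spikes of level `N` have an abscissa `j / 3 ^ N`. -/
theorem exists_fst_eq {p : ℝ × ℝ} (hp : p ∈ comb) {N : ℕ} (h : spikeHeight N < p.2) :
    ∃ j : ℕ, p.1 = j * spikeHeight N := by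
  rcases mem_comb_cases hp with ⟨s, hs, rfl⟩ | ⟨n, j, t, hn, hj, h0, h1, rfl⟩
  · exact absurd h (spikeHeight_pos N).le.not_gt
  · have hnN : n ≤ N := by
      by_contra! hlt
      exact (h.trans_le h1).not_ge (spikeHeight_anti hlt.le)
    obtain ⟨k, rfl⟩ := Nat.exists_eq_add_of_le hnN
    refine ⟨j * 3 ^ k, ?_⟩
    simp only [spikeBase, spikeHeight, pow_add]
    push_cast
    field_simp

/-- Both abscissas are integer multiples of `spikeHeight N`. -/
theorem fst_eq_of_abs_sub_lt {p q : ℝ × ℝ} (hp : p ∈ comb) (hq : q ∈ comb) {N : ℕ}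
    (hpN : spikeHeight N < p.2) (hqN : spikeHeight N < q.2)
    (h : |q.1 - p.1| < spikeHeight N) : q.1 = p.1 := by
  obtain ⟨i, hi⟩ := exists_fst_eq hp hpN
  obtain ⟨j, hj⟩ := exists_fst_eq hq hqN
  have hpos := spikeHeight_pos N
  rw [hi, hj, ← sub_mul, abs_mul, abs_of_pos hpos] at h
  have h1 : |(j : ℝ) - i| < 1 := by
    by_contra! hle
    nlinarith
  have h2 : |(j : ℤ) - i| < 1 := by exact_mod_cast h1
  have h3 : (j : ℤ) = i := sub_eq_zero.1 (Int.abs_lt_one_iff.1 h2)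
  rw [hi, hj, show j = i by exact_mod_cast h3]

/-- The comb is the intersection over `N` of the closed sets made of the finitely many spikes of
level at most `N` and the strip of height `spikeHeight N` over the unit interval. -/
theorem isClosed_comb : IsClosed comb := by
  have hfin : ∀ n, (spikeIndices n).Finite := fun n =>
    (Set.finite_Iic (3 ^ n)).subset fun j hj => hj.2.1
  have hspike : ∀ n, IsClosed ((spikeBase n '' spikeIndices n) ×ˢ Icc (0 : ℝ) (spikeHeight n)) :=
    fun n => ((hfin n).image _).isClosed.prod isClosed_Icc
  have hcl : ∀ N : ℕ, IsClosed ((⋃ n ∈ {n : ℕ | 1 ≤ n ∧ n ≤ N},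
      (spikeBase n '' spikeIndices n) ×ˢ Icc (0 : ℝ) (spikeHeight n)) ∪
      Icc (0 : ℝ) 1 ×ˢ Icc (0 : ℝ) (spikeHeight N)) := fun N =>
    (((Set.finite_Iic N).subset fun n hn => hn.2).isClosed_biUnion fun n _ => hspike n).union
      (isClosed_Icc.prod isClosed_Icc)
  convert isClosed_iInter hcl
  ext p
  rw [mem_iInter]
  constructor
  · intro hp N
    rcases mem_comb_cases hp with ⟨s, hs, rfl⟩ | ⟨n, j, t, hn, hj, h0, h1, rfl⟩
    · exact Or.inr ⟨hs, le_rfl, (spikeHeight_pos N).le⟩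
    · rcases le_total n N with hnN | hnN
      · exact Or.inl (mem_biUnion (show n ∈ {n : ℕ | 1 ≤ n ∧ n ≤ N} from ⟨hn, hnN⟩)
          ⟨⟨j, hj, rfl⟩, h0.le, h1⟩)
      · exact Or.inr ⟨spikeBase_mem_Icc hj, h0.le, h1.trans (spikeHeight_anti hnN)⟩
  · intro h
    have key : ∀ N, p ∈ (⋃ n ∈ {n : ℕ | 1 ≤ n ∧ n ≤ N},
        (spikeBase n '' spikeIndices n) ×ˢ Icc (0 : ℝ) (spikeHeight n)) → p ∈ comb := by
      intro N hN
      simp only [mem_iUnion, mem_ofPred_eq, exists_prop] at hN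
      obtain ⟨n, hn, hp⟩ := hN
      exact Or.inr (mem_biUnion (show n ∈ {n : ℕ | 1 ≤ n} from hn.1) hp)
    rcases h 0 with h0 | ⟨hx, hy0, -⟩
    · exact key 0 h0
    · rcases hy0.eq_or_lt with hy | hy
      · exact Or.inl ⟨hx, hy.symm⟩
      · obtain ⟨N, hN⟩ := exists_spikeHeight_lt hy
        rcases h N with h1 | ⟨-, -, hle⟩
        · exact key N h1
        · exact absurd hN hle.not_gt

theorem isCompact_comb : IsCompact comb := by
  refine (isCompact_Icc.prod isCompact_Icc : IsCompact
    (Icc (0 : ℝ) 1 ×ˢ Icc (0 : ℝ) 1)).of_isClosed_subset isClosed_comb fun p hp => ?_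
  exact ⟨comb_fst_mem hp, comb_snd_nonneg hp, comb_snd_le_one hp⟩

instance : CompactSpace comb := isCompact_iff_compactSpace.1 isCompact_comb

/-- The part of the comb over an interval and below a positive height is connected. -/
theorem isPreconnected_comb_inter {I : Set ℝ} (hI : Convex ℝ I) {c : ℝ} (hc : 0 < c) :
    IsPreconnected {p : ℝ × ℝ | p ∈ comb ∧ p.1 ∈ I ∧ p.2 < c} := by
  have hbase : IsPreconnected ((I ∩ Icc (0 : ℝ) 1) ×ˢ {(0 : ℝ)}) :=
    ((hI.inter (convex_Icc 0 1)).isPreconnected).prod isPreconnected_singleton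
  refine isPreconnected_of_forall_pair ?_
  rintro ⟨x, y⟩ ⟨hp, hpI, hpc⟩ ⟨x', y'⟩ ⟨hq, hqI, hqc⟩
  have hvert : ∀ {x y : ℝ}, (x, y) ∈ comb →
      IsPreconnected (({x} : Set ℝ) ×ˢ Icc (0 : ℝ) y) := fun _ =>
    isPreconnected_singleton.prod isPreconnected_Icc
  have hx := comb_fst_mem hp
  have hx' := comb_fst_mem hq
  have hy := comb_snd_nonneg hp
  have hy' := comb_snd_nonneg hq
  have h1 : IsPreconnected
      (({x} : Set ℝ) ×ˢ Icc (0 : ℝ) y ∪ (I ∩ Icc (0 : ℝ) 1) ×ˢ {(0 : ℝ)}) :=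
    (hvert hp).union (x, 0) (mk_mem_prod rfl ⟨le_rfl, hy⟩) ⟨⟨hpI, hx⟩, rfl⟩ hbase
  have h2 : IsPreconnected
      (({x} : Set ℝ) ×ˢ Icc (0 : ℝ) y ∪ (I ∩ Icc (0 : ℝ) 1) ×ˢ {(0 : ℝ)} ∪
        ({x'} : Set ℝ) ×ˢ Icc (0 : ℝ) y') :=
    h1.union (x', 0) (Or.inr ⟨⟨hqI, hx'⟩, rfl⟩) (mk_mem_prod rfl ⟨le_rfl, hy'⟩) (hvert hq)
  refine ⟨_, ?_, Or.inl (Or.inl ⟨rfl, hy, le_rfl⟩), Or.inr ⟨rfl, hy', le_rfl⟩, h2⟩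
  rintro ⟨s, t⟩ ((⟨hs, ht0, ht1⟩ | ⟨⟨hsI, hs⟩, ht⟩) | ⟨hs, ht0, ht1⟩)
  · obtain rfl : s = x := hs
    exact ⟨comb_down hp ht0 ht1, hpI, lt_of_le_of_lt ht1 hpc⟩
  · obtain rfl : t = 0 := ht
    exact ⟨base_mem_comb hs, hsI, hc⟩
  · obtain rfl : s = x' := hs
    exact ⟨comb_down hq ht0 ht1, hqI, lt_of_le_of_lt ht1 hqc⟩

theorem isPreconnected_preimage_comb {S : Set (ℝ × ℝ)}
    (h : IsPreconnected {p : ℝ × ℝ | p ∈ comb ∧ p ∈ S}) :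
    IsPreconnected {p : comb | (p : ℝ × ℝ) ∈ S} := by
  rw [← Topology.IsInducing.subtypeVal.isPreconnected_image]
  convert h
  ext p
  simp [and_comm]

instance : ConnectedSpace comb where
  isPreconnected_univ := by
    have := isPreconnected_preimage_comb (S := {p | p.1 ∈ univ ∧ p.2 < 2})
      (isPreconnected_comb_inter convex_univ zero_lt_two)
    convert this
    ext p
    have := comb_snd_le_one p.2
    simp only [mem_univ, mem_ofPred_eq, true_and, true_iff]
    linarith
  toNonempty := ⟨rightEnd⟩

/-- Near a point of a spike above height `c`, the comb is a vertical segment. -/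
theorem exists_pos_fst_eq (p : comb) {c : ℝ} (hc : 0 < c) (hpc : c < (p : ℝ × ℝ).2) :
    ∃ r > 0, ∀ q : comb, c < (q : ℝ × ℝ).2 → |(q : ℝ × ℝ).1 - (p : ℝ × ℝ).1| < r →
      (q : ℝ × ℝ).1 = (p : ℝ × ℝ).1 := by
  obtain ⟨N, hN⟩ := exists_spikeHeight_lt hc
  exact ⟨spikeHeight N, spikeHeight_pos N, fun q hq h =>
    fst_eq_of_abs_sub_lt p.2 q.2 (hN.trans hpc) (hN.trans hq) h⟩

theorem eventually_fst_eq (p : comb) (hp : 0 < (p : ℝ × ℝ).2) :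
    ∀ᶠ q : comb in 𝓝 p, (q : ℝ × ℝ).1 = (p : ℝ × ℝ).1 := by
  obtain ⟨r, hr, h⟩ := exists_pos_fst_eq p (half_pos hp) (half_lt_self hp)
  have h1 : ∀ᶠ q : comb in 𝓝 p, (p : ℝ × ℝ).2 / 2 < (q : ℝ × ℝ).2 :=
    (continuous_subtype_val.snd.tendsto p).eventually (lt_mem_nhds (half_lt_self hp))
  have h2 : ∀ᶠ q : comb in 𝓝 p, |(q : ℝ × ℝ).1 - (p : ℝ × ℝ).1| < r := by
    have := (continuous_subtype_val.fst.tendsto p).eventually (Metric.ball_mem_nhds _ hr)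
    simpa only [Metric.mem_ball, Real.dist_eq] using this
  filter_upwards [h1, h2] with q hq1 hq2 using h q hq1 hq2

theorem mem_ball_comb {p q : comb} {r : ℝ} : q ∈ Metric.ball p r ↔
    |(q : ℝ × ℝ).1 - (p : ℝ × ℝ).1| < r ∧ |(q : ℝ × ℝ).2 - (p : ℝ × ℝ).2| < r := by
  rw [Metric.mem_ball, Subtype.dist_eq, Prod.dist_eq, max_lt_iff, Real.dist_eq, Real.dist_eq]

instance : LocallyConnectedSpace comb := by
  rw [locallyConnectedSpace_iff_connected_subsets]
  intro p U hU
  obtain ⟨r, hr, hrU⟩ := Metric.mem_nhds_iff.1 hU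
  rcases (comb_snd_nonneg p.2).eq_or_lt with hp | hp
  -- In the max metric, a ball about a base point is the part of the comb over an interval and below
  -- height `r`.
  · refine ⟨Metric.ball p r, Metric.ball_mem_nhds p hr, ?_, hrU⟩
    convert isPreconnected_preimage_comb
      (isPreconnected_comb_inter (convex_ball (p : ℝ × ℝ).1 r) hr) using 1
    ext q
    have hq := comb_snd_nonneg q.2
    change q ∈ Metric.ball p r ↔ (q : ℝ × ℝ).1 ∈ Metric.ball (p : ℝ × ℝ).1 r ∧ (q : ℝ × ℝ).2 < r
    rw [mem_ball_comb, ← hp, sub_zero, abs_of_nonneg hq, Metric.mem_ball, Real.dist_eq]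
  -- A ball about a point above the base may meet several spikes; its part on the spike of `p` is
  -- still a neighbourhood.
  · refine ⟨{q | (q : ℝ × ℝ).1 = (p : ℝ × ℝ).1} ∩ Metric.ball p r,
      inter_mem (eventually_fst_eq p hp) (Metric.ball_mem_nhds p hr), ?_,
      inter_subset_right.trans hrU⟩
    have hconn : IsPreconnected {q : ℝ × ℝ | q ∈ comb ∧ (q.1 = (p : ℝ × ℝ).1 ∧
        |q.2 - (p : ℝ × ℝ).2| < r)} := by
      have hI : OrdConnected {t : ℝ | ((p : ℝ × ℝ).1, t) ∈ comb ∧ |t - (p : ℝ × ℝ).2| < r} := by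
        refine ⟨fun a ha b hb t ht => ⟨comb_down hb.1 ((comb_snd_nonneg ha.1).trans ht.1) ht.2, ?_⟩⟩
        have h1 := abs_lt.1 ha.2
        have h2 := abs_lt.1 hb.2
        rw [abs_lt]
        constructor <;> linarith [ht.1, ht.2]
      have := (isPreconnected_singleton (x := (p : ℝ × ℝ).1)).prod hI.isPreconnected
      convert this using 1
      ext ⟨s, t⟩
      simp only [mem_ofPred_eq, mem_prod, mem_singleton_iff]
      constructor
      · rintro ⟨h1, rfl, h2⟩
        exact ⟨rfl, h1, h2⟩
      · rintro ⟨rfl, h1, h2⟩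
        exact ⟨h1, rfl, h2⟩
    convert isPreconnected_preimage_comb (S := {q | q.1 = (p : ℝ × ℝ).1 ∧
      |q.2 - (p : ℝ × ℝ).2| < r}) hconn using 1
    ext q
    rw [mem_inter_iff, mem_ball_comb]
    simp only [mem_ofPred_eq]
    constructor
    · rintro ⟨h1, -, h2⟩
      exact ⟨h1, h2⟩
    · rintro ⟨h1, h2⟩
      exact ⟨h1, by simpa [h1] using hr, h2⟩

/-- The Borsuk–Ulam theorem in dimension one. -/
theorem not_injective_of_continuous_circle {g : Circle → ℝ} (hg : Continuous g) :
    ¬ Function.Injective g := by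
  intro hinj
  have hneg : ∀ z : Circle, z * Circle.exp Real.pi ≠ z := fun z h => by
    have h1 : Circle.exp Real.pi = 1 := mul_eq_left.1 h
    have h2 := congrArg (fun z : Circle => (z : ℂ)) h1
    simp only [Circle.coe_exp, Complex.exp_pi_mul_I, Circle.coe_one] at h2
    norm_num at h2
  have hsq : Circle.exp Real.pi * Circle.exp Real.pi = 1 := by
    rw [← Circle.exp_add, ← two_mul, Circle.exp_two_pi]
  -- The difference of `g` at antipodal points changes sign between `0` and `π`, hence vanishes
  -- somewhere.
  let h : ℝ → ℝ := fun t => g (Circle.exp t) - g (Circle.exp t * Circle.exp Real.pi)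
  have hcont : Continuous h := by fun_prop
  have hpi : h Real.pi = - h 0 := by
    simp only [h, Circle.exp_zero, one_mul, hsq]
    ring
  have hz : ∃ t, h t = 0 := by
    rcases le_total (h 0) 0 with h0 | h0
    · exact mem_range_of_exists_le_of_exists_ge hcont ⟨0, h0⟩ ⟨Real.pi, by linarith⟩
    · exact mem_range_of_exists_le_of_exists_ge hcont ⟨Real.pi, by linarith⟩ ⟨0, h0⟩
  obtain ⟨t, ht⟩ := hz
  exact hneg _ (hinj (sub_eq_zero.1 ht)).symm

theorem isPreconnected_circle_compl_singleton (w : Circle) : IsPreconnected ({w}ᶜ : Set Circle) := by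
  have himg : ({w}ᶜ : Set Circle) =
      (fun t => w * Circle.exp t) '' Ioo (0 : ℝ) (2 * Real.pi) := by
    ext z
    simp only [mem_compl_iff, mem_singleton_iff, mem_image]
    constructor
    · intro hz
      obtain ⟨t, ht, he⟩ := Circle.periodic_exp.exists_mem_Ico₀ Real.two_pi_pos
        (Complex.arg (w⁻¹ * z : Circle))
      rw [Circle.exp_arg] at he
      refine ⟨t, ⟨ht.1.lt_of_ne fun h0 => hz ?_, ht.2⟩, ?_⟩
      · rw [← h0, Circle.exp_zero, inv_mul_eq_one] at he
        exact he.symm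
      · rw [← he]
        group
    · rintro ⟨t, ht, rfl⟩ h
      rw [mul_eq_left, Circle.exp_eq_one] at h
      obtain ⟨m, hm⟩ := h
      rw [hm] at ht
      have h1 : (0 : ℝ) < m := by
        by_contra! hle
        nlinarith [ht.1, Real.two_pi_pos]
      have h2 : (m : ℝ) < 1 := by
        by_contra! hle
        nlinarith [ht.2, Real.two_pi_pos]
      have h3 : (0 : ℤ) < m := by exact_mod_cast h1
      have h4 : m < (1 : ℤ) := by exact_mod_cast h2
      omega
  rw [himg]
  exact isPreconnected_Ioo.image _ (by fun_prop)

/-- A connected subset of the comb that contains a point above height `c` of a spike, but not the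
point at height `c`, lies on the spike. -/
theorem fst_eq_of_isPreconnected {K : Set comb} (hK : IsPreconnected K) {p : comb} (hp : p ∈ K)
    {c : ℝ} (hc : 0 < c) (hpc : c < (p : ℝ × ℝ).2)
    (hKc : ∀ q ∈ K, (q : ℝ × ℝ) ≠ ((p : ℝ × ℝ).1, c)) :
    ∀ q ∈ K, (q : ℝ × ℝ).1 = (p : ℝ × ℝ).1 := by
  obtain ⟨r, hr, h⟩ := exists_pos_fst_eq p hc hpc
  have hf : Continuous fun q : comb => (q : ℝ × ℝ).1 := continuous_subtype_val.fst
  have hs : Continuous fun q : comb => (q : ℝ × ℝ).2 := continuous_subtype_val.snd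
  -- `U` reaches only the open upper part of the spike, and `V` is the complement of its closed
  -- upper part. Together they miss just the point at height `c`.
  let U : Set comb := {q | c < (q : ℝ × ℝ).2 ∧ |(q : ℝ × ℝ).1 - (p : ℝ × ℝ).1| < r}
  let V : Set comb := {q | (q : ℝ × ℝ).1 = (p : ℝ × ℝ).1 ∧ c ≤ (q : ℝ × ℝ).2}ᶜ
  have hU : IsOpen U := (isOpen_lt continuous_const hs).inter
    (isOpen_lt (hf.sub continuous_const).abs continuous_const)
  have hV : IsOpen V := ((isClosed_eq hf continuous_const).inter
    (isClosed_le continuous_const hs)).isOpen_compl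
  have hUV : Disjoint U V := by
    rw [Set.disjoint_left]
    exact fun q hqU hqV => hqV ⟨h q hqU.1 hqU.2, hqU.1.le⟩
  have hcover : K ⊆ U ∪ V := by
    intro q hq
    by_cases hqV : q ∈ V
    · exact Or.inr hqV
    · obtain ⟨h1, h2⟩ := not_not.1 hqV
      refine Or.inl ⟨h2.lt_of_ne fun h3 => hKc q hq (Prod.ext h1 h3.symm), ?_⟩
      simpa [h1] using hr
  have hsub := hK.subset_left_of_subset_union hU hV hUV hcover
    ⟨p, hp, hpc, by simpa using hr⟩
  exact fun q hq => h q (hsub hq).1 (hsub hq).2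

/-- If the image leaves the base at `e z`, injectivity lets at most one point of the circle map to
half the height of `e z`. The rest is connected and so stays on that spike. The image thus lies on
the base or on one vertical line, and a coordinate would embed the circle in the real line. -/
theorem not_injective_circle_comb {e : Circle → comb} (he : Continuous e) :
    ¬ Function.Injective e := by
  intro hinj
  have hval : Continuous fun z => (e z : ℝ × ℝ) := continuous_subtype_val.comp he
  by_cases hbase : ∀ z, (e z : ℝ × ℝ).2 = 0
  · exact not_injective_of_continuous_circle hval.fst fun z w hzw =>
      hinj (Subtype.ext (Prod.ext hzw ((hbase z).trans (hbase w).symm)))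
  push Not at hbase
  obtain ⟨z, hz⟩ := hbase
  have hpos : 0 < (e z : ℝ × ℝ).2 := (comb_snd_nonneg (e z).2).lt_of_ne hz.symm
  have hline : ∀ w, (e w : ℝ × ℝ).1 = (e z : ℝ × ℝ).1 := by
    by_cases hv : ∃ v, (e v : ℝ × ℝ) = ((e z : ℝ × ℝ).1, (e z : ℝ × ℝ).2 / 2)
    · obtain ⟨v, hv⟩ := hv
      have hzv : z ≠ v := by
        rintro rfl
        have := congrArg Prod.snd hv
        dsimp only at this
        linarith
      have := fst_eq_of_isPreconnected
        ((isPreconnected_circle_compl_singleton v).image e he.continuousOn)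
        (mem_image_of_mem e (show z ∈ ({v}ᶜ : Set Circle) from hzv)) (half_pos hpos)
        (half_lt_self hpos) (by
          rintro - ⟨w, hw, rfl⟩ h
          exact hw (hinj (Subtype.ext (h.trans hv.symm))))
      intro w
      by_cases hwv : w = v
      · rw [hwv, hv]
      · exact this _ (mem_image_of_mem e hwv)
    · push Not at hv
      have := fst_eq_of_isPreconnected (isPreconnected_univ.image e he.continuousOn)
        (mem_image_of_mem e (mem_univ z)) (half_pos hpos) (half_lt_self hpos) (by
          rintro - ⟨w, -, rfl⟩
          exact hv w)
      exact fun w => this _ (mem_image_of_mem e (mem_univ w))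
  exact not_injective_of_continuous_circle hval.snd fun a b hab =>
    hinj (Subtype.ext (Prod.ext ((hline a).trans (hline b).symm) hab))

theorem isDendrite_comb : IsDendrite comb := by
  refine ⟨inferInstance, inferInstance, inferInstance, ?_⟩
  rintro S ⟨e⟩
  exact not_injective_circle_comb (continuous_subtype_val.comp e.symm.continuous)
    (Subtype.val_injective.comp e.symm.injective)

/-! ### Continuity of the map -/

theorem continuous_combMap : Continuous combMap := by
  rw [continuous_iff_continuousAt]
  intro p
  rw [Topology.IsInducing.subtypeVal.continuousAt_iff]
  have hs : Continuous fun q : comb => (q : ℝ × ℝ).2 := continuous_subtype_val.snd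
  rcases mem_comb_cases p.2 with ⟨s, -, hp⟩ | ⟨n, j, t, -, hj, h0, -, hp⟩
  · have hfix : combMapAux (p : ℝ × ℝ) = p := by rw [hp, combMapAux_base]
    have hd : Tendsto (fun q : comb => dist (combMapAux q) (q : ℝ × ℝ)) (𝓝 p) (𝓝 0) := by
      refine squeeze_zero (fun _ => dist_nonneg) (fun q => dist_combMapAux_le q.2) ?_
      have := (hs.const_mul 3).tendsto p
      rwa [show (p : ℝ × ℝ).2 = 0 by rw [hp], mul_zero] at this
    change Tendsto (fun q : comb => combMapAux q) (𝓝 p) (𝓝 (combMapAux p))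
    rw [hfix]
    exact (tendsto_iff_of_dist hd).2 (continuous_subtype_val.tendsto p)
  · have hG : Continuous fun u : ℝ =>
        (lowerPart n j (min u (2 / 3 * spikeHeight n)), max 0 (upperPart n j u)) := by
      unfold lowerPart upperPart
      fun_prop
    refine (hG.comp hs).continuousAt.congr ?_
    have hpos : 0 < (p : ℝ × ℝ).2 := by rw [hp]; exact h0
    filter_upwards [eventually_fst_eq p hpos] with q hq
    have hq' : (q : ℝ × ℝ) = (spikeBase n j, (q : ℝ × ℝ).2) :=
      Prod.ext (hq.trans (by rw [hp])) rfl
    have hq0 := comb_snd_nonneg q.2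
    change _ = combMapAux q
    conv_rhs => rw [hq', combMapAux_spike hj hq0]
    rfl

/-! ### Visits of the orbit of the tips -/

/-- Within a level the sweep is monotone and advances by at least one multiple of `spikeHeight (n +
1)` per step. -/
theorem sub_mul_spikeHeight_le {n i k : ℕ} (hik : i ≤ k) (hk : k < 2 * 3 ^ n) :
    ((k : ℝ) - i) * spikeHeight (n + 1) ≤
      |(sweepPoint (3 ^ n + k)).1 - (sweepPoint (3 ^ n + i)).1| := by
  rw [sweepPoint_pow_add hk, sweepPoint_pow_add (hik.trans_lt hk)]
  dsimp only
  have hpos := spikeHeight_pos (n + 1)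
  rw [spikeBase_eq, spikeBase_eq, ← sub_mul, abs_mul, abs_of_pos hpos]
  gcongr
  rw [le_abs]
  have hpow := pow_succ 3 n
  by_cases he : Even n
  · left
    have : k + sweepIndex n i ≤ sweepIndex n k + i := by
      simp only [sweepIndex, he, if_true]; omega
    have : (k : ℝ) + sweepIndex n i ≤ sweepIndex n k + i := by exact_mod_cast this
    linarith
  · right
    have : k + sweepIndex n k ≤ sweepIndex n i + i := by
      simp only [sweepIndex, he, if_false]; omega
    have : (k : ℝ) + sweepIndex n k ≤ sweepIndex n i + i := by exact_mod_cast this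
    linarith

section Visits

variable {s δ : ℝ}

/-- Two visits within `δ` of `s` have bases less than `2 * δ` apart, so their times differ by less
than `2 * δ / spikeHeight (n + 1)`, which is `6 * δ * 3 ^ n`. -/
theorem count_level_le (hδ : 0 < δ) {n b : ℕ} (hb : b ≤ 2 * 3 ^ n) :
    (Nat.count (fun i => |s - (sweepPoint (3 ^ n + i)).1| < δ) b : ℝ) ≤ 6 * δ * 3 ^ n + 1 := by
  refine count_le_of_sub_lt (by positivity) fun i k hik hk hi hk' => ?_
  have h := sub_mul_spikeHeight_le hik (hk.trans_le hb)
  have hlt : |(sweepPoint (3 ^ n + k)).1 - (sweepPoint (3 ^ n + i)).1| < 2 * δ := by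
    rw [abs_lt] at *
    constructor <;> linarith
  have hpos := spikeHeight_pos (n + 1)
  have h2 := h.trans_lt hlt
  have he : 2 * δ / spikeHeight (n + 1) = 6 * δ * 3 ^ n := by
    simp only [spikeHeight, pow_succ]
    field_simp
    ring
  rwa [← lt_div_iff₀ hpos, he] at h2

theorem count_pow_le (hδ : 0 < δ) (m : ℕ) :
    (Nat.count (fun N => |s - (sweepPoint N).1| < δ) (3 ^ m) : ℝ) ≤ 3 * δ * 3 ^ m + m + 1 := by
  induction m with
  | zero =>
    -- The final `+ 1` of the bound absorbs the index `N = 0`, which is not a time of the orbit.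
    have h : (Nat.count (fun N => |s - (sweepPoint N).1| < δ) 1 : ℝ) ≤ 1 := by
      exact_mod_cast Nat.count_le _
    simp only [pow_zero, Nat.cast_zero]
    linarith
  | succ m ih =>
    rw [show 3 ^ (m + 1) = 3 ^ m + 2 * 3 ^ m by ring, Nat.count_add, pow_succ]
    push_cast
    have := count_level_le (s := s) hδ (le_refl (2 * 3 ^ m))
    linarith

theorem sq_le_three_pow (n : ℕ) : n ^ 2 ≤ 3 ^ n := by
  induction n with
  | zero => norm_num
  | succ n ih =>
    rcases Nat.lt_or_ge n 2 with h | h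
    · interval_cases n <;> norm_num
    · rw [pow_succ 3]
      nlinarith

theorem count_visits_le (hδ : 0 < δ) (N : ℕ) :
    (Nat.count (fun N => |s - (sweepPoint N).1| < δ) N : ℝ) ≤ (2 + 1 / δ) + 10 * δ * N := by
  rcases Nat.eq_zero_or_pos N with rfl | hN
  · simp only [Nat.count_zero, Nat.cast_zero]
    positivity
  obtain ⟨n, i, hi, rfl⟩ := exists_eq_pow_add hN
  rw [Nat.count_add]
  push_cast
  have h1 := count_pow_le (s := s) hδ n
  have h2 := count_level_le (s := s) hδ hi.le
  -- The `n` comes from the error 1 per level. Once `n ≥ 1 / δ`, it is at most `δ * n ^ 2 ≤ δ * 3 ^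
  -- n`, which raises the slope from 9 to 10.
  have h3 : (n : ℝ) ≤ 1 / δ + δ * 3 ^ n := by
    rcases le_total (n : ℝ) (1 / δ) with h | h
    · have : 0 < δ * 3 ^ n := by positivity
      linarith
    · have hsq : (n : ℝ) ^ 2 ≤ 3 ^ n := by exact_mod_cast sq_le_three_pow n
      have h4 : 1 ≤ n * δ := (div_le_iff₀ hδ).1 h
      have h5 : (n : ℝ) ≤ δ * n ^ 2 := by nlinarith [Nat.cast_nonneg (α := ℝ) n]
      have h6 : δ * (n : ℝ) ^ 2 ≤ δ * 3 ^ n := by gcongr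
      have h7 : 0 < 1 / δ := by positivity
      linarith
  have h8 : 0 ≤ δ * i := by positivity
  linarith

end Visits

theorem count_le_add_count {p q : ℕ → Prop} [DecidablePred p] [DecidablePred q] {a : ℕ}
    (h : ∀ k, a ≤ k → p k → q k) (b : ℕ) : Nat.count p b ≤ a + Nat.count q b := by
  induction b with
  | zero => simp
  | succ b ih =>
    rcases Nat.lt_or_ge b a with hb | hb
    · have := Nat.count_le p (n := b + 1)
      omega
    · rw [Nat.count_succ, Nat.count_succ]
      have := h b hb
      split_ifs <;> first | omega | tauto

/-! ### The scrambled pairs of the comb -/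

theorem one_le_diam_comb : 1 ≤ Metric.diam (univ : Set comb) := by
  have h := Metric.dist_le_diam_of_mem (isCompact_univ (X := comb)).isBounded
    (mem_univ (⟨(0, 0), base_mem_comb ⟨le_rfl, zero_le_one⟩⟩ : comb)) (mem_univ rightEnd)
  rw [Subtype.dist_eq, Prod.dist_eq] at h
  refine le_trans ?_ ((le_max_left _ _).trans h)
  simp [rightEnd]

theorem dist_iterate (k : ℕ) (x y : comb) :
    dist (combMap^[k] x) (combMap^[k] y) =
      dist (combMapAux^[k] (x : ℝ × ℝ)) (combMapAux^[k] (y : ℝ × ℝ)) := by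
  rw [Subtype.dist_eq, coe_combMap_iterate, coe_combMap_iterate]

theorem iterate_eq_of_le {p : ℝ × ℝ} {a : ℕ} {s : ℝ} (h : combMapAux^[a] p = (s, 0)) {k : ℕ}
    (hk : a ≤ k) : combMapAux^[k] p = (s, 0) := by
  obtain ⟨d, rfl⟩ := Nat.exists_eq_add_of_le' hk
  rw [Function.iterate_add_apply, h, iterate_base]

/-- After time `a` the distance is at least the horizontal one, so closeness means a visit of the
sweep near `s`. -/
theorem tendsto_upperDist_of_base_of_tip {x y : comb} {a : ℕ} {s : ℝ}
    (hx : combMapAux^[a] (x : ℝ × ℝ) = (s, 0)) {A : ℕ} (hA : 1 ≤ A)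
    (hy : (y : ℝ × ℝ) = sweepPoint A) :
    Tendsto (upperDist combMap x y) (𝓝[>] 0) (𝓝 0) := by
  refine tendsto_upperDist_zero (C := 10) zero_lt_one fun δ hδ _ =>
    upperDist_le_of_count_le (K := a + (2 + 1 / δ) + 10 * δ * (A + 1)) fun n => ?_
  have h1 : Nat.count (fun k => dist (combMap^[k] x) (combMap^[k] y) < δ) (n + 1) ≤
      a + Nat.count (fun k => |s - (sweepPoint (A + k)).1| < δ) (n + 1) := by
    refine count_le_add_count (fun k hk hlt => ?_) _
    rw [dist_iterate, iterate_eq_of_le hx hk, hy, iterate_sweepPoint k hA, Prod.dist_eq] at hlt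
    exact (le_max_left _ _).trans_lt hlt
  have h2 := count_visits_le (s := s) hδ (A + (n + 1))
  rw [Nat.count_add] at h2
  have h3 : (Nat.count (fun k => dist (combMap^[k] x) (combMap^[k] y) < δ) (n + 1) : ℝ) ≤
      a + Nat.count (fun k => |s - (sweepPoint (A + k)).1| < δ) (n + 1) := by exact_mod_cast h1
  push_cast at h2
  have h4 : (0 : ℝ) ≤ Nat.count (fun N => |s - (sweepPoint N).1| < δ) A := Nat.cast_nonneg _
  linarith

theorem not_scrambled (x y : comb) : ¬ IsDC2Pair combMap x y ∧ ¬ IsDC2HalfPair combMap x y := by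
  have hd : 0 < Metric.diam (univ : Set comb) := zero_lt_one.trans_le one_le_diam_comb
  rcases eventually_base_or_tip x with ⟨a, s, hx⟩ | ⟨n, j, hn, hj, hx⟩ <;>
    rcases eventually_base_or_tip y with ⟨b, t, hy⟩ | ⟨m, i, hm, hi, hy⟩
  · have hev : ∀ᶠ k in atTop, dist (combMap^[k] x) (combMap^[k] y) = |s - t| := by
      filter_upwards [eventually_ge_atTop a, eventually_ge_atTop b] with k ha hb
      rw [dist_iterate, iterate_eq_of_le hx ha, iterate_eq_of_le hy hb]
      simp [Prod.dist_eq, Real.dist_eq]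
    rcases (abs_nonneg (s - t)).eq_or_lt with h0 | h0
    · refine not_scrambled_of_asymptotic (tendsto_const_nhds.congr' ?_)
      filter_upwards [hev] with k hk
      rw [hk, ← h0]
    · exact not_scrambled_of_tendsto_upperDist hd
        (tendsto_upperDist_zero_of_le_dist h0 (hev.mono fun k hk => hk.ge))
  · obtain ⟨A, hA, he⟩ := exists_sweepPoint_eq hm hi
    exact not_scrambled_of_tendsto_upperDist hd
      (tendsto_upperDist_of_base_of_tip hx hA (hy.trans he.symm))
  · obtain ⟨A, hA, he⟩ := exists_sweepPoint_eq hn hj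
    refine not_scrambled_of_tendsto_upperDist hd ?_
    rw [upperDist_comm]
    exact tendsto_upperDist_of_base_of_tip hy hA (hx.trans he.symm)
  · obtain ⟨A, hA, hA'⟩ := exists_sweepPoint_eq hn hj
    obtain ⟨B, hB, hB'⟩ := exists_sweepPoint_eq hm hi
    refine not_scrambled_of_asymptotic ?_
    have he : ∀ k, dist (combMap^[k] x) (combMap^[k] y) =
        dist (sweepPoint (A + k)) (sweepPoint (B + k)) := fun k => by
      rw [dist_iterate, hx, hy, ← hA', ← hB', iterate_sweepPoint k hA, iterate_sweepPoint k hB]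
    simp only [he]
    rcases le_total A B with h | h
    · exact tendsto_dist_sweepPoint hA h
    · simp only [dist_comm (sweepPoint (A + _))]
      exact tendsto_dist_sweepPoint hB h

/-- From the last third of one level to the first third of the next, the orbit of the tips stays
in the right third for odd `m`, in the left third for even `m`. -/
theorem sweepPoint_third {m N : ℕ} (h1 : 7 * 3 ^ m ≤ N) (h2 : N < 15 * 3 ^ m) :
    (Odd m → 2 / 3 < (sweepPoint N).1) ∧ (Even m → (sweepPoint N).1 < 1 / 3) ∧
      (sweepPoint N).2 < 1 / 3 := by
  have hE := Nat.even_add_one (n := m)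
  have hno := Nat.not_even_iff_odd (n := m)
  have hpos : (0 : ℝ) < 3 ^ m := by positivity
  have hpos' : 0 < 3 ^ m := by positivity
  have hone : (1 : ℝ) ≤ 3 ^ m := one_le_pow₀ (by norm_num)
  rcases Nat.lt_or_ge N (9 * 3 ^ m) with h | h
  · obtain ⟨i, rfl⟩ := Nat.exists_eq_add_of_le (show 3 ^ (m + 1) ≤ N by rw [pow_succ]; omega)
    rw [pow_succ] at h h1
    rw [sweepPoint_pow_add (by rw [pow_succ]; omega)]
    have hp : (3 : ℝ) ^ (m + 1 + 1) = 9 * 3 ^ m := by ring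
    have hpn : 3 ^ (m + 1 + 1) = 9 * 3 ^ m := by ring
    refine ⟨fun ho => ?_, fun he => ?_, ?_⟩
    · have he' : Even (m + 1) := hE.2 (hno.2 ho)
      have : 6 * 3 ^ m < sweepIndex (m + 1) i := by
        simp only [sweepIndex, he', if_true]; omega
      have : 6 * (3 : ℝ) ^ m < sweepIndex (m + 1) i := by exact_mod_cast this
      dsimp only
      rw [spikeBase, hp, lt_div_iff₀ (by positivity)]
      linarith
    · have he' : ¬ Even (m + 1) := fun h => hE.1 h he
      have : sweepIndex (m + 1) i < 3 * 3 ^ m := by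
        simp only [sweepIndex, he', if_false, hpn]; omega
      have : (sweepIndex (m + 1) i : ℝ) < 3 * (3 : ℝ) ^ m := by exact_mod_cast this
      dsimp only
      rw [spikeBase, hp, div_lt_iff₀ (by positivity)]
      linarith
    · dsimp only
      rw [spikeHeight, hp, div_lt_div_iff₀ (by positivity) (by positivity)]
      linarith
  · have hpn' : 3 ^ (m + 1 + 1) = 9 * 3 ^ m := by ring
    obtain ⟨i, rfl⟩ := Nat.exists_eq_add_of_le (show 3 ^ (m + 1 + 1) ≤ N by omega)
    rw [hpn'] at h2
    rw [sweepPoint_pow_add (by omega)]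
    have hp : (3 : ℝ) ^ (m + 1 + 1 + 1) = 27 * 3 ^ m := by ring
    have hpn : 3 ^ (m + 1 + 1 + 1) = 27 * 3 ^ m := by ring
    refine ⟨fun ho => ?_, fun he => ?_, ?_⟩
    · have he' : ¬ Even (m + 1 + 1) := fun h => Nat.even_add_one.1 h (hE.2 (hno.2 ho))
      have : 18 * 3 ^ m < sweepIndex (m + 1 + 1) i := by
        simp only [sweepIndex, he', if_false, hpn]; omega
      have : 18 * (3 : ℝ) ^ m < sweepIndex (m + 1 + 1) i := by exact_mod_cast this
      dsimp only
      rw [spikeBase, hp, lt_div_iff₀ (by positivity)]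
      linarith
    · have he' : Even (m + 1 + 1) := Nat.even_add_one.2 fun h => hE.1 h he
      have : sweepIndex (m + 1 + 1) i < 9 * 3 ^ m := by
        simp only [sweepIndex, he', if_true]; omega
      have : (sweepIndex (m + 1 + 1) i : ℝ) < 9 * (3 : ℝ) ^ m := by exact_mod_cast this
      dsimp only
      rw [spikeBase, hp, div_lt_iff₀ (by positivity)]
      linarith
    · dsimp only
      rw [spikeHeight, hp, div_lt_div_iff₀ (by positivity) (by positivity)]
      linarith

theorem dist_rightEnd_firstTip (k : ℕ) :
    dist (combMap^[k] rightEnd) (combMap^[k] firstTip) =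
      max |1 - (sweepPoint (k + 1)).1| |0 - (sweepPoint (k + 1)).2| := by
  have h1 : (firstTip : ℝ × ℝ) = sweepPoint 1 := sweepPoint_one.symm
  have h2 : (rightEnd : ℝ × ℝ) = (1, 0) := rfl
  rw [dist_iterate, h1, h2, iterate_base, iterate_sweepPoint k le_rfl, add_comm 1 k, Prod.dist_eq,
    Real.dist_eq, Real.dist_eq]

theorem tendsto_third_times : Tendsto (fun m : ℕ => 15 * 3 ^ m - 2) atTop atTop := by
  refine tendsto_atTop_mono (fun m => ?_) tendsto_id
  have h1 : m < 3 ^ m := Nat.lt_pow_self (by norm_num)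
  simp only [id]
  omega

theorem isDC3Pair_comb : IsDC3Pair combMap rightEnd firstTip := by
  -- For these `δ`, tips in the right third at height below `1/3` are `δ`-close to `(1, 0)`, and
  -- tips in the left third are not.
  refine ⟨1 / 3, 2 / 3, by norm_num, by norm_num, by linarith [one_le_diam_comb], ?_⟩
  rintro δ ⟨h1, h2⟩
  -- Time `k` corresponds to `sweepPoint (k + 1)`, so `k ≤ 15 * 3 ^ m - 2` covers exactly the
  -- indices from 1 to `15 * 3 ^ m - 1`.
  have hfreq : ∀ m : ℕ, closeFreq combMap rightEnd firstTip δ (15 * 3 ^ m - 2) =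
      (Nat.count (fun k => dist (combMap^[k] rightEnd) (combMap^[k] firstTip) < δ)
        (15 * 3 ^ m - 1) : ℝ) / (15 * 3 ^ m - 2) := fun m => by
    have h3 : 1 ≤ 3 ^ m := Nat.one_le_pow _ _ (by norm_num)
    rw [closeFreq_eq_count, show 15 * 3 ^ m - 2 + 1 = 15 * 3 ^ m - 1 by omega,
      Nat.cast_sub (by omega)]
    push_cast
    rfl
  have hup : 8 / 15 ≤ upperDist combMap rightEnd firstTip δ := by
    refine le_limsup_of_frequently_le ?_ (isBoundedUnder_le_closeFreq _ _ _ _)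
    refine tendsto_third_times.frequently (Nat.frequently_odd.mono fun m hm => ?_)
    have h3 : 1 ≤ 3 ^ m := Nat.one_le_pow _ _ (by norm_num)
    have h3' : (1 : ℝ) ≤ 3 ^ m := by exact_mod_cast h3
    have hc : (15 * 3 ^ m - 1) - (7 * 3 ^ m - 1) ≤
        Nat.count (fun k => dist (combMap^[k] rightEnd) (combMap^[k] firstTip) < δ)
          (15 * 3 ^ m - 1) := sub_le_count fun k hk hk' => by
      obtain ⟨hx, -, hy⟩ := sweepPoint_third (m := m) (N := k + 1) (by omega) (by omega)
      have hmem := sweepPoint_mem (N := k + 1) (by omega)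
      have hx1 := (comb_fst_mem hmem).2
      have hy0 := comb_snd_nonneg hmem
      have hx' := hx hm
      rw [dist_rightEnd_firstTip, max_lt_iff, abs_lt, abs_lt]
      refine ⟨⟨?_, ?_⟩, ?_, ?_⟩ <;> linarith
    have hc' : 8 * 3 ^ m ≤ Nat.count (fun k => dist (combMap^[k] rightEnd)
        (combMap^[k] firstTip) < δ) (15 * 3 ^ m - 1) := by omega
    have hc'' : 8 * (3 : ℝ) ^ m ≤ Nat.count (fun k => dist (combMap^[k] rightEnd)
        (combMap^[k] firstTip) < δ) (15 * 3 ^ m - 1) := by exact_mod_cast hc'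
    rw [hfreq, le_div_iff₀ (by linarith)]
    linarith
  have hlow : lowerDist combMap rightEnd firstTip δ ≤ 1 / 2 := by
    refine liminf_le_of_frequently_le ?_ (isBoundedUnder_ge_closeFreq _ _ _ _)
    refine tendsto_third_times.frequently (Nat.frequently_even.mono fun m hm => ?_)
    have h3 : 1 ≤ 3 ^ m := Nat.one_le_pow _ _ (by norm_num)
    have h3' : (1 : ℝ) ≤ 3 ^ m := by exact_mod_cast h3
    -- All close times precede the stay in the left third; `(7 * 3 ^ m - 1) / (15 * 3 ^ m - 2)` is
    -- below `1/2`, which is less than `8/15`.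
    have hc : Nat.count (fun k => dist (combMap^[k] rightEnd) (combMap^[k] firstTip) < δ)
          (15 * 3 ^ m - 1) ≤ 7 * 3 ^ m - 1 := count_le_of_forall_not fun k hk hk' => by
      obtain ⟨-, hx, -⟩ := sweepPoint_third (m := m) (N := k + 1) (by omega) (by omega)
      have hx' := hx hm
      rw [dist_rightEnd_firstTip, not_lt]
      refine le_trans ?_ ((le_abs_self _).trans (le_max_left _ _))
      linarith
    have hc' : Nat.count (fun k => dist (combMap^[k] rightEnd)
        (combMap^[k] firstTip) < δ) (15 * 3 ^ m - 1) + 1 ≤ 7 * 3 ^ m := by omega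
    have hc'' : (Nat.count (fun k => dist (combMap^[k] rightEnd)
        (combMap^[k] firstTip) < δ) (15 * 3 ^ m - 1) : ℝ) + 1 ≤ 7 * (3 : ℝ) ^ m := by
      exact_mod_cast hc'
    rw [hfreq, div_le_iff₀ (by linarith)]
    linarith
  linarith

end DistChaos

theorem mainTheorem1 :
    -- the comb is a dendrite, and the map on it is continuous
    (IsDendrite comb ∧ Continuous combMap) ∧
    -- the system has a DC3 pair, but no DC2 pair and no DC2½ pair
    IsDC3Pair combMap rightEnd firstTip ∧
    (∀ x y : comb, ¬ IsDC2Pair combMap x y) ∧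
    (∀ x y : comb, ¬ IsDC2HalfPair combMap x y) ∧
    -- hence, on dendrites, DC3 implies neither DC2 nor DC2½
    (¬ ∀ (X : Type) [MetricSpace X] (g : X → X), IsDendrite X → Continuous g →
        (∃ x y : X, IsDC3Pair g x y) → ∃ x y : X, IsDC2Pair g x y) ∧
    (¬ ∀ (X : Type) [MetricSpace X] (g : X → X), IsDendrite X → Continuous g →
        (∃ x y : X, IsDC3Pair g x y) → ∃ x y : X, IsDC2HalfPair g x y) := by
  have hpair : ∃ x y : comb, IsDC3Pair combMap x y := ⟨_, _, isDC3Pair_comb⟩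
  refine ⟨⟨isDendrite_comb, continuous_combMap⟩, isDC3Pair_comb, fun x y => (not_scrambled x y).1,
    fun x y => (not_scrambled x y).2, fun h => ?_, fun h => ?_⟩
  · obtain ⟨x, y, hxy⟩ := h comb combMap isDendrite_comb continuous_combMap hpair
    exact (not_scrambled x y).1 hxy
  · obtain ⟨x, y, hxy⟩ := h comb combMap isDendrite_comb continuous_combMap hpair
    exact (not_scrambled x y).2 hxy
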